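/- Theorem 1. For every $\delta\in(0,1]$ there is a constant $C_\delta$, depending only on $\delta$, with the following property. Let $\xi_1,\dots,\xi_n$ be independent real random variables with finite moments of all orders, $\mathbf{E}\xi_i=0$, satisfying Bernstein's condition $$|\mathbf{E}\xi_i^k|\le \tfrac12\, k!\,\varepsilon^{k-2}\,\mathbf{E}\xi_i^2\qquad (k\ge 3,\ i=1,\dots,n)$$ for some constant $\varepsilon>0$. Let $S_n=\sum_{i=1}^n\xi_i$, $\sigma^2=\sum_{i=1}^n\mathbf{E}\xi_i^2$ with $\sigma>0$, and let $\Phi$ be the standard normal distribution function. Then for all $x\ge 0$, $$\mathbf{P}(S_n>x\sigma)\le\bigl(1-\Phi(\widetilde x)\bigr)\Bigl[1+C_\delta\,(1+\widetilde x)\,\frac{\varepsilon}{\sigma}\Bigr],\qquad \widetilde x=\frac{2x}{1+\sqrt{1+2(1+\delta)x\varepsilon/\sigma}}.$$ In particular, for every fixed $\delta\in(0,1]$: if the variables $\xi_i$ (with their number $n$ and underlying probability space), $\varepsilon$ and $x$ vary along a sequence, or more generally an arbitrary family indexed by a set with a filter, in such a way that the above assumptions always hold, $x\ge 0$, $\varepsilon/\sigma\to0$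 and $x=o(\sigma/\varepsilon)$, then $$\mathbf{P}(S_n>x\sigma)\le\bigl(1-\Phi(\widetilde x)\bigr)\,[1+o(1)].$$ -/

import Mathlib

open MeasureTheory ProbabilityTheory Filter Topology Asymptotics

/-- The standard normal distribution function `Φ`. -/
noncomputable def stdNormalCDF (x : ℝ) : ℝ := cdf (gaussianReal 0 1) x

/-- `ξ 0, …, ξ (n-1)` are independent centered real random variables having moments of all orders
and satisfying Bernstein's condition with constant `ε > 0`:
`|E ξᵢ ^ k| ≤ (1/2) k! ε ^ (k - 2) E ξᵢ ^ 2` for all `k ≥ 3` and all `i`. -/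
structure IsBernsteinFamily {Ω : Type*} [MeasurableSpace Ω] (P : Measure Ω) {n : ℕ}
    (ξ : Fin n → Ω → ℝ) (ε : ℝ) : Prop where
  eps_pos : 0 < ε
  measurable : ∀ i, Measurable (ξ i)
  indep : iIndepFun ξ P
  integrable_pow : ∀ i, ∀ k : ℕ, Integrable (fun ω => ξ i ω ^ k) P
  centered : ∀ i, ∫ ω, ξ i ω ∂P = 0
  bernstein : ∀ i, ∀ k : ℕ, 3 ≤ k →
    |∫ ω, ξ i ω ^ k ∂P| ≤ 1 / 2 * (Nat.factorial k : ℝ) * ε ^ (k - 2) * ∫ ω, ξ i ω ^ 2 ∂P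

/-- `σ = √(∑ E ξᵢ ^ 2)`. -/
noncomputable def sumSigma {Ω : Type*} [MeasurableSpace Ω] (P : Measure Ω) {n : ℕ}
    (ξ : Fin n → Ω → ℝ) : ℝ :=
  √(∑ i, ∫ ω, ξ i ω ^ 2 ∂P)

/-- `P (Sₙ > x σ)` with `Sₙ = ∑ ξᵢ`. -/
noncomputable def sumTail {Ω : Type*} [MeasurableSpace Ω] (P : Measure Ω) {n : ℕ}
    (ξ : Fin n → Ω → ℝ) (x : ℝ) : ℝ :=
  P.real {ω | ∑ i, ξ i ω > x * sumSigma P ξ}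

/-- `x̃ = 2x / (1 + √(1 + 2 (1 + δ) x r))`, to be used with `r = ε / σ`. -/
noncomputable def xTilde (δ r x : ℝ) : ℝ := 2 * x / (1 + √(1 + 2 * (1 + δ) * x * r))

/-!
After replacing `ξᵢ` by `ξᵢ / σ` the sum `S` has variance `1` and Bernstein's condition holds with
`r = ε / σ`. The function `b = xTilde δ r x` solves `x = b + (1 + δ) r b² / 2`, and for `δ = 0`
Bernstein's exponential inequality with its optimal parameter reads `P (S > x) ≤ exp (-a² / 2)`
with `a = xTilde 0 r x ≥ b` (`measureReal_sum_gt_le_exp`). What separates this from the claim is the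
factor `1 - Φ(b)` in place of `exp (-b² / 2)`, which is smaller by the order of `1 + b`. Two regimes
are treated differently.

* If `x r > 1 / 2000`, then `a² - b²` is at least of order `δ / r²` (`le_xTilde_zero_sq_sub`), so
  `exp (-a² / 2)` is `exp (-b² / 2)` times a factor that beats `r / δ`, whence the bound
  `C (1 + b) r (1 - Φ(b))` by the lower estimate of the Mills ratio
  (`measureReal_sum_gt_le_of_large`). Only here does the constant depend on `δ`.

* If `x r ≤ 1 / 2000`, there is a saddle point `t`, for which `S` has mean `x` under the product of
  the conjugate laws `exp (t y) μᵢ(dy) / E exp (t ξᵢ)` (`exists_sum_conjMean_eq`), and `P (S > x)`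
  is `∏ E exp (t ξᵢ) · exp (-t x)` times the conjugate expectation of `1_{S > x} exp (-t (S - x))`
  (`measureReal_sum_gt_eq`). The saddle point minimizes the prefactor over `t`, so Bernstein's
  bound applies to it and gives at most `exp (-a² / 2) ≤ exp (-b² / 2)`
  (`prod_integral_exp_saddle_le`). The conjugate expectation is within twice the Kolmogorov
  distance of its Gaussian value, a multiple of the Mills ratio at `t v`, where `v²` is the
  conjugate variance (`integral_conj_indicator_exp_le`). Since `x` and `v` are within relative
  errors `O(t r)` of `t` and `1`, and `b ≤ x`, passing from `t v` to `b` costs `O(r)` (`mills_mul_le`),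
  which the lower bound `1 / (5 (1 + b))` for the Mills ratio turns into the relative error
  `O((1 + b) r)`.

The Kolmogorov distance is controlled by the Berry–Esseen inequality for sums of independent
variables with different laws (`IsCenteredIndep.berry_esseen`), proved by Stein's method with a
concentration inequality. The third absolute moments it needs are not part of Bernstein's condition;
they are recovered from the even moments through the hyperbolic cosine
(`IsBernsteinLaw.integral_pow_three_mul_exp_le`).
-/

/-! ### The Gaussian tail and the Mills ratio -/

/-- The Mills ratio without its factor `1 / √(2π)`, written as a Laplace transform, so that it makes
sense (and is finite) for all real `t`: `mills t = exp (t² / 2) ∫_t^∞ exp (-u² / 2) du`. -/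
noncomputable def mills (t : ℝ) : ℝ := ∫ s in Set.Ioi (0 : ℝ), Real.exp (-(t * s) - s ^ 2 / 2)

lemma integrable_mills_integrand (t : ℝ) :
    Integrable (fun s : ℝ => Real.exp (-(t * s) - s ^ 2 / 2)) := by
  have h := (integrable_exp_neg_mul_sq (b := 1 / 2) (by norm_num)).comp_add_right t
  have h2 := h.const_mul (Real.exp (t ^ 2 / 2))
  refine h2.congr (Eventually.of_forall fun s => ?_)
  simp only
  rw [← Real.exp_add]
  congr 1
  ring

lemma gaussianPDFReal_std (x : ℝ) :
    gaussianPDFReal 0 1 x = (√(2 * Real.pi))⁻¹ * Real.exp (-x ^ 2 / 2) := by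
  simp [gaussianPDFReal]

lemma integral_Ioi_comp_add (f : ℝ → ℝ) (t : ℝ) :
    ∫ s in Set.Ioi (0 : ℝ), f (s + t) = ∫ u in Set.Ioi t, f u := by
  have := (measurePreserving_add_right volume t).setIntegral_preimage_emb
    (measurableEmbedding_addRight t) f (Set.Ioi t)
  rw [← this]
  congr 2
  ext s
  simp

lemma one_sub_stdNormalCDF (t : ℝ) :
    1 - stdNormalCDF t = (√(2 * Real.pi))⁻¹ * Real.exp (-t ^ 2 / 2) * mills t := by
  have h1 : 1 - stdNormalCDF t = (gaussianReal 0 1).real (Set.Ioi t) := by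
    rw [stdNormalCDF, cdf_eq_real, ← Set.compl_Iic, probReal_compl_eq_one_sub measurableSet_Iic]
  have h2 : (gaussianReal 0 1).real (Set.Ioi t) = ∫ u in Set.Ioi t, gaussianPDFReal 0 1 u := by
    rw [measureReal_def, gaussianReal_apply_eq_integral _ one_ne_zero, ENNReal.toReal_ofReal]
    exact integral_nonneg fun u => gaussianPDFReal_nonneg _ _ _
  rw [h1, h2, ← integral_Ioi_comp_add, mills, ← integral_const_mul]
  congr 1
  ext s
  rw [gaussianPDFReal_std, mul_assoc, ← Real.exp_add]
  congr 2
  ring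

lemma stdNormalCDF_neg (t : ℝ) : stdNormalCDF (-t) = 1 - stdNormalCDF t := by
  have h1 : 1 - stdNormalCDF t = (gaussianReal 0 1).real (Set.Ioi t) := by
    rw [stdNormalCDF, cdf_eq_real, ← Set.compl_Iic, probReal_compl_eq_one_sub measurableSet_Iic]
  have hn := nullSingletonClass_gaussianReal (μ := 0) (v := 1) one_ne_zero
  rw [h1, stdNormalCDF, cdf_eq_real]
  have h := gaussianReal_map_neg (μ := 0) (v := 1)
  rw [neg_zero] at h
  conv_lhs => rw [← h]
  rw [measureReal_def, Measure.map_apply (by fun_prop) measurableSet_Iic, measureReal_def,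
    measure_congr Ioi_ae_eq_Ici]
  congr 2
  ext s
  simp

lemma stdNormalCDF_nonneg (t : ℝ) : 0 ≤ stdNormalCDF t := cdf_nonneg _ _

lemma stdNormalCDF_le_one (t : ℝ) : stdNormalCDF t ≤ 1 := cdf_le_one _ _

lemma stdNormalCDF_mono : Monotone stdNormalCDF := monotone_cdf _

lemma hasDerivAt_stdNormalCDF (t : ℝ) : HasDerivAt stdNormalCDF (gaussianPDFReal 0 1 t) t := by
  have hc : Continuous (gaussianPDFReal 0 1) := by
    have : gaussianPDFReal 0 1 = fun x => (√(2 * Real.pi))⁻¹ * Real.exp (-x ^ 2 / 2) :=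
      funext gaussianPDFReal_std
    rw [this]
    fun_prop
  have hi := integrable_gaussianPDFReal 0 1
  have h2 (s : ℝ) : stdNormalCDF s = ∫ u in Set.Iic s, gaussianPDFReal 0 1 u := by
    rw [stdNormalCDF, cdf_eq_real, measureReal_def,
      gaussianReal_apply_eq_integral _ one_ne_zero, ENNReal.toReal_ofReal]
    exact integral_nonneg fun u => gaussianPDFReal_nonneg _ _ _
  have h3 : stdNormalCDF = fun s => stdNormalCDF t + ∫ u in t..s, gaussianPDFReal 0 1 u := by
    ext s
    rw [← intervalIntegral.integral_Iic_sub_Iic hi.integrableOn hi.integrableOn, ← h2, ← h2]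
    ring
  rw [h3]
  exact (intervalIntegral.integral_hasDerivAt_right (hi.intervalIntegrable)
    (hc.stronglyMeasurableAtFilter _ _) hc.continuousAt).const_add _

lemma sqrt_two_pi_pos : 0 < √(2 * Real.pi) := Real.sqrt_pos.2 (by positivity)

lemma mills_eq (t : ℝ) :
    mills t = √(2 * Real.pi) * Real.exp (t ^ 2 / 2) * (1 - stdNormalCDF t) := by
  rw [one_sub_stdNormalCDF]
  have h : Real.exp (-t ^ 2 / 2) = (Real.exp (t ^ 2 / 2))⁻¹ := by
    rw [← Real.exp_neg]; ring_nf
  have := sqrt_two_pi_pos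
  rw [h]
  field_simp

lemma hasDerivAt_mills (t : ℝ) : HasDerivAt mills (t * mills t - 1) t := by
  have h1 : mills = fun t => √(2 * Real.pi) * Real.exp (t ^ 2 / 2) * (1 - stdNormalCDF t) :=
    funext mills_eq
  have h2 : HasDerivAt (fun t : ℝ => √(2 * Real.pi) * Real.exp (t ^ 2 / 2))
      (√(2 * Real.pi) * (Real.exp (t ^ 2 / 2) * t)) t := by
    have : HasDerivAt (fun t : ℝ => t ^ 2 / 2) t t := by
      simpa using (hasDerivAt_pow 2 t).div_const 2
    exact this.exp.const_mul _
  have h3 := h2.mul ((hasDerivAt_stdNormalCDF t).const_sub 1)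
  rw [h1]
  refine h3.congr_deriv ?_
  have h : Real.exp (-t ^ 2 / 2) = (Real.exp (t ^ 2 / 2))⁻¹ := by
    rw [← Real.exp_neg]; ring_nf
  have := sqrt_two_pi_pos
  rw [gaussianPDFReal_std, h]
  field_simp
  ring

lemma mills_anti {a b : ℝ} (h : a ≤ b) : mills b ≤ mills a := by
  refine setIntegral_mono_on (integrable_mills_integrand b).integrableOn
    (integrable_mills_integrand a).integrableOn measurableSet_Ioi fun s hs => ?_
  have hs : 0 < s := hs
  gcongr

lemma exp_half_le_two : Real.exp (1 / 2) ≤ 2 := by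
  have h := Real.exp_one_lt_d9
  have h2 : Real.exp (1 / 2) ^ 2 = Real.exp 1 := by
    rw [← Real.exp_nat_mul]; norm_num
  nlinarith [Real.exp_pos (1 / 2)]

/-- The elementary inequality `s - 1 / 2 ≤ s² / 2` turns the Gaussian factor into an exponential
one, so that Gamma integrals bound the Mills ratio and its increments. -/
lemma mills_integrand_le (t s : ℝ) :
    Real.exp (-(t * s) - s ^ 2 / 2) ≤ 2 * Real.exp (-((1 + t) * s)) := by
  calc Real.exp (-(t * s) - s ^ 2 / 2) ≤ Real.exp (1 / 2 + -((1 + t) * s)) := by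
        gcongr; nlinarith [sq_nonneg (s - 1)]
    _ ≤ _ := by rw [Real.exp_add]; gcongr; exact exp_half_le_two

lemma mills_le {t : ℝ} (ht : 0 ≤ t) : mills t ≤ 2 / (1 + t) := by
  have h1 : ∫ s in Set.Ioi (0 : ℝ), Real.exp (-(1 + t) * s) = 1 / (1 + t) := by
    rw [integral_exp_mul_Ioi (by linarith), mul_zero, Real.exp_zero, neg_div_neg_eq]
  have h0 : IntegrableOn (fun s : ℝ => Real.exp (-(1 + t) * s)) (Set.Ioi 0) :=
    exp_neg_integrableOn_Ioi 0 (by linarith)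
  calc mills t ≤ ∫ s in Set.Ioi (0 : ℝ), 2 * Real.exp (-(1 + t) * s) := by
        refine setIntegral_mono_on (integrable_mills_integrand t).integrableOn
          (h0.const_mul 2) measurableSet_Ioi fun s _ => ?_
        simpa only [neg_mul] using mills_integrand_le t s
    _ = 2 / (1 + t) := by rw [integral_const_mul, h1]; ring

lemma mills_sub_le {a b : ℝ} (ha : 0 ≤ a) (hab : a ≤ b) :
    mills a - mills b ≤ 2 * (b - a) / (1 + a) ^ 2 := by
  have h1 : ∫ s in Set.Ioi (0 : ℝ), s * Real.exp (-((1 + a) * s)) = 1 / (1 + a) ^ 2 := by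
    have := Real.integral_rpow_mul_exp_neg_mul_Ioi (a := 2) (r := 1 + a) (by norm_num) (by linarith)
    norm_num at this
    simpa using this
  have h0 : IntegrableOn (fun s : ℝ => s * Real.exp (-((1 + a) * s))) (Set.Ioi 0) := by
    have := integrableOn_rpow_mul_exp_neg_mul_rpow (s := 1) (p := 1) (b := 1 + a)
      (by norm_num) (by norm_num) (by linarith)
    simpa only [neg_mul, Real.rpow_one] using this
  rw [mills, mills, ← integral_sub (integrable_mills_integrand a).integrableOn
    (integrable_mills_integrand b).integrableOn]
  calc _ ≤ ∫ s in Set.Ioi (0 : ℝ), 2 * (b - a) * (s * Real.exp (-((1 + a) * s))) := by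
        refine setIntegral_mono_on ((integrable_mills_integrand a).sub
          (integrable_mills_integrand b)).integrableOn
          (h0.const_mul _) measurableSet_Ioi fun s hs => ?_
        have hs : 0 < s := hs
        have e1 : Real.exp (-(b * s) - s ^ 2 / 2)
            = Real.exp (-(a * s) - s ^ 2 / 2) * Real.exp (-((b - a) * s)) := by
          rw [← Real.exp_add]; congr 1; ring
        have e2 := Real.add_one_le_exp (-((b - a) * s))
        have e3 := mills_integrand_le a s
        have e4 : 0 ≤ (b - a) * s := mul_nonneg (by linarith) hs.le
        rw [e1]
        nlinarith [mul_le_mul_of_nonneg_left e2 (Real.exp_pos (-(a * s) - s ^ 2 / 2)).le,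
          mul_le_mul_of_nonneg_right e3 e4]
    _ = _ := by rw [integral_const_mul, h1]; ring

/-- The integrand is at least `exp (-3 / 2) ≥ 1 / 5` on `(0, 1 / (1 + t)]`. -/
lemma le_mills {t : ℝ} (ht : 0 ≤ t) : 1 / (5 * (1 + t)) ≤ mills t := by
  have hpos : 0 < 1 / (1 + t) := by positivity
  have h1 : ∫ s in Set.Ioc (0 : ℝ) (1 / (1 + t)), (1 / 5 : ℝ) = 1 / (5 * (1 + t)) := by
    have h : 0 ≤ 1 + t := by linarith
    simp [h]
  rw [← h1]
  have e5 : (1 / 5 : ℝ) ≤ Real.exp (-(3 / 2)) := by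
    rw [Real.exp_neg, one_div]
    apply inv_anti₀ (Real.exp_pos _)
    have h := Real.exp_one_lt_d9
    have h2 : Real.exp (3 / 2) = Real.exp 1 * Real.exp (1 / 2) := by
      rw [← Real.exp_add]; norm_num
    have h3 : Real.exp (1 / 2) ^ 2 = Real.exp 1 := by
      rw [← Real.exp_nat_mul]; norm_num
    have h4 : Real.exp (1 / 2) ≤ 1.65 := by nlinarith [Real.exp_pos (1 / 2)]
    rw [h2]; nlinarith [Real.exp_pos 1, Real.exp_pos (1/2)]
  calc _ ≤ ∫ s in Set.Ioc (0 : ℝ) (1 / (1 + t)), Real.exp (-(t * s) - s ^ 2 / 2) := by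
        refine setIntegral_mono_on (by simp) (integrable_mills_integrand t).integrableOn
          measurableSet_Ioc fun s hs => e5.trans ?_
        have h1 := hs.1
        have h2 : s * (1 + t) ≤ 1 := (le_div_iff₀ (by linarith)).1 hs.2
        gcongr
        nlinarith [mul_nonneg h1.le ht]
    _ ≤ _ := setIntegral_mono_set (integrable_mills_integrand t).integrableOn
        (Eventually.of_forall fun s => (Real.exp_pos _).le)
        (Eventually.of_forall fun s hs => hs.1)

lemma integral_exp_neg_indicator_gaussian (a : ℝ) :
    ∫ y, (Set.Ioi (0 : ℝ)).indicator (fun y => Real.exp (-(a * y))) y ∂(gaussianReal 0 1)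
      = (√(2 * Real.pi))⁻¹ * mills a := by
  rw [integral_gaussianReal_eq_integral_smul one_ne_zero, mills, ← integral_const_mul,
    ← integral_indicator measurableSet_Ioi]
  congr 1
  ext y
  by_cases hy : y ∈ Set.Ioi (0 : ℝ)
  · simp only [Set.indicator_of_mem hy, gaussianPDFReal_std, smul_eq_mul]
    rw [mul_assoc, ← Real.exp_add]
    congr 2
    ring
  · simp [Set.indicator_of_notMem hy]

/-! ### The solution of Stein's equation for a half-line -/

/-- The bounded solution `f` of Stein's equation `f' w - w f w = 1_{w ≤ z} - Φ z`. -/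
noncomputable def steinSol (z w : ℝ) : ℝ :=
  if w ≤ z then mills (-w) * (1 - stdNormalCDF z) else mills w * stdNormalCDF z

/-- The derivative of `steinSol z`, read off from Stein's equation; at the kink `w = z` this is
the left derivative. -/
noncomputable def steinDeriv (z w : ℝ) : ℝ :=
  w * steinSol z w + (if w ≤ z then 1 else 0) - stdNormalCDF z

lemma mills_neg_mul (w : ℝ) :
    mills (-w) * (1 - stdNormalCDF w) = mills w * stdNormalCDF w := by
  rw [mills_eq, mills_eq, stdNormalCDF_neg, neg_sq]
  ring

lemma mills_nonneg (t : ℝ) : 0 ≤ mills t :=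
  integral_nonneg fun _ => (Real.exp_pos _).le

lemma steinSol_of_ge {z w : ℝ} (h : z ≤ w) : steinSol z w = mills w * stdNormalCDF z := by
  rcases h.eq_or_lt with rfl | h
  · simp [steinSol, mills_neg_mul]
  · simp [steinSol, not_le.2 h]

lemma steinSol_nonneg (z w : ℝ) : 0 ≤ steinSol z w := by
  have h1 := stdNormalCDF_nonneg z
  have h2 := stdNormalCDF_le_one z
  unfold steinSol
  split_ifs
  · exact mul_nonneg (mills_nonneg _) (by linarith)
  · exact mul_nonneg (mills_nonneg _) h1

lemma steinSol_le_mills_abs (z w : ℝ) : steinSol z w ≤ mills |w| := by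
  have h1 := stdNormalCDF_nonneg z
  have h2 := stdNormalCDF_le_one z
  have h3 := stdNormalCDF_nonneg w
  have h4 := stdNormalCDF_le_one w
  have m1 := mills_nonneg w
  have m2 := mills_nonneg (-w)
  have h := mills_neg_mul w
  rcases le_total w z with hw | hw
  · have h5 := stdNormalCDF_mono hw
    rw [steinSol, if_pos hw]
    rcases le_total 0 w with h0 | h0
    · rw [abs_of_nonneg h0]; nlinarith
    · rw [abs_of_nonpos h0]; nlinarith
  · have h5 := stdNormalCDF_mono hw
    rw [steinSol_of_ge hw]
    rcases le_total 0 w with h0 | h0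
    · rw [abs_of_nonneg h0]; nlinarith
    · rw [abs_of_nonpos h0]; nlinarith

lemma one_add_abs_mul_steinSol_le (z w : ℝ) : (1 + |w|) * steinSol z w ≤ 2 := by
  have h := (steinSol_le_mills_abs z w).trans (mills_le (abs_nonneg w))
  rw [le_div_iff₀ (by positivity)] at h
  linarith

lemma abs_steinSol_le (z w : ℝ) : |steinSol z w| ≤ 2 := by
  have h := one_add_abs_mul_steinSol_le z w
  have h0 := steinSol_nonneg z w
  rw [abs_of_nonneg h0]
  nlinarith [mul_nonneg (abs_nonneg w) h0]

lemma abs_mul_steinSol_le (z w : ℝ) : |w * steinSol z w| ≤ 2 := by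
  have h := one_add_abs_mul_steinSol_le z w
  have h0 := steinSol_nonneg z w
  rw [abs_mul, abs_of_nonneg h0]
  nlinarith

lemma abs_steinDeriv_le (z w : ℝ) : |steinDeriv z w| ≤ 3 := by
  have h := abs_le.1 (abs_mul_steinSol_le z w)
  have h1 := stdNormalCDF_nonneg z
  have h2 := stdNormalCDF_le_one z
  rw [steinDeriv, abs_le]
  split_ifs <;> constructor <;> linarith

lemma hasDerivAt_mills_neg_mul (z w : ℝ) :
    HasDerivAt (fun w => mills (-w) * (1 - stdNormalCDF z))
      (w * (mills (-w) * (1 - stdNormalCDF z)) + 1 - stdNormalCDF z) w := by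
  have h := ((hasDerivAt_mills (-w)).comp w (hasDerivAt_neg w)).mul_const (1 - stdNormalCDF z)
  exact h.congr_deriv (by ring)

lemma hasDerivAt_mills_mul (z w : ℝ) :
    HasDerivAt (fun w => mills w * stdNormalCDF z)
      (w * (mills w * stdNormalCDF z) - stdNormalCDF z) w :=
  ((hasDerivAt_mills w).mul_const (stdNormalCDF z)).congr_deriv (by ring)

lemma hasDerivAt_steinSol {z w : ℝ} (h : w ≠ z) :
    HasDerivAt (steinSol z) (steinDeriv z w) w := by
  rcases h.lt_or_gt with h | h
  · have h1 : steinSol z =ᶠ[𝓝 w] fun w => mills (-w) * (1 - stdNormalCDF z) := by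
      filter_upwards [Iio_mem_nhds h] with u hu
      simp [steinSol, (show u < z from hu).le]
    refine (hasDerivAt_mills_neg_mul z w).congr_of_eventuallyEq h1 |>.congr_deriv ?_
    simp [steinDeriv, steinSol, h.le]
  · have h1 : steinSol z =ᶠ[𝓝 w] fun w => mills w * stdNormalCDF z := by
      filter_upwards [Ioi_mem_nhds h] with u hu
      exact steinSol_of_ge (show z < u from hu).le
    refine (hasDerivAt_mills_mul z w).congr_of_eventuallyEq h1 |>.congr_deriv ?_
    simp [steinDeriv, steinSol, not_le.2 h]

lemma continuous_steinSol (z : ℝ) : Continuous (steinSol z) := by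
  have h1 : Continuous mills :=
    continuous_iff_continuousAt.2 fun t => (hasDerivAt_mills t).continuousAt
  refine Continuous.if_le (by fun_prop) (by fun_prop) continuous_id continuous_const ?_
  rintro w rfl
  exact mills_neg_mul _

lemma measurable_steinDeriv (z : ℝ) : Measurable (steinDeriv z) := by
  have := (continuous_steinSol z).measurable
  unfold steinDeriv
  refine ((measurable_id.mul this).add ?_).sub_const _
  exact Measurable.ite measurableSet_Iic measurable_const measurable_const

/-- The right derivative exists everywhere, also at the kink, and is bounded by `3`. -/
lemma abs_steinSol_sub_le (z u v : ℝ) : |steinSol z v - steinSol z u| ≤ 3 * |v - u| := by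
  wlog huv : u ≤ v generalizing u v
  · rw [abs_sub_comm, abs_sub_comm v]
    exact this v u (le_of_not_ge huv)
  have h1 : ∀ x ∈ Set.Ico u v, HasDerivWithinAt (steinSol z)
      (if x < z then steinDeriv z x else x * (mills x * stdNormalCDF z) - stdNormalCDF z)
      (Set.Ici x) x := by
    intro x hx
    split_ifs with hxz
    · exact (hasDerivAt_steinSol hxz.ne).hasDerivWithinAt
    · have hxz := not_lt.1 hxz
      refine (hasDerivAt_mills_mul z x).hasDerivWithinAt.congr (fun y hy => ?_) ?_
      · exact steinSol_of_ge (hxz.trans hy)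
      · exact steinSol_of_ge hxz
  have h2 : ∀ x ∈ Set.Ico u v,
      ‖if x < z then steinDeriv z x else x * (mills x * stdNormalCDF z) - stdNormalCDF z‖ ≤ 3 := by
    intro x _
    split_ifs with hxz
    · exact abs_steinDeriv_le z x
    · rw [← steinSol_of_ge (not_lt.1 hxz), Real.norm_eq_abs, abs_le]
      have h := abs_le.1 (abs_mul_steinSol_le z x)
      have h1 := stdNormalCDF_nonneg z
      have h2 := stdNormalCDF_le_one z
      constructor <;> linarith
  rw [abs_of_nonneg (sub_nonneg.2 huv)]
  exact norm_image_sub_le_of_norm_deriv_right_le_segment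
    (continuous_steinSol z).continuousOn h1 h2 v ⟨huv, le_rfl⟩

lemma abs_mul_steinSol_sub_le (z w t : ℝ) :
    |(w + t) * steinSol z (w + t) - w * steinSol z w| ≤ |t| * (2 + 3 * |w|) := by
  have h1 := abs_steinSol_le z (w + t)
  have h2 := abs_steinSol_sub_le z w (w + t)
  rw [add_sub_cancel_left] at h2
  calc |(w + t) * steinSol z (w + t) - w * steinSol z w|
      = |t * steinSol z (w + t) + w * (steinSol z (w + t) - steinSol z w)| := by congr 1; ring
    _ ≤ |t| * |steinSol z (w + t)| + |w| * |steinSol z (w + t) - steinSol z w| := by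
        rw [← abs_mul, ← abs_mul]; exact abs_add_le _ _
    _ ≤ |t| * 2 + |w| * (3 * |t|) := by gcongr
    _ = _ := by ring

/-- The indicator that a step of length at most `|t|` from `w` may reach the kink `z`. -/
noncomputable def nearKink (z w t : ℝ) : ℝ := if |w - z| ≤ |t| then 1 else 0

lemma nearKink_nonneg (z w t : ℝ) : 0 ≤ nearKink z w t := by
  unfold nearKink; split_ifs <;> norm_num

lemma nearKink_le_one (z w t : ℝ) : nearKink z w t ≤ 1 := by
  unfold nearKink; split_ifs <;> norm_num

lemma le_iff_of_abs_lt {z w t s : ℝ} (h : |t| < |w - z|) (hs : |s| ≤ |t|) :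
    w + s ≤ z ↔ w ≤ z := by
  obtain ⟨h1, h2⟩ := abs_le.1 hs
  rcases le_or_gt w z with h0 | h0
  · rw [abs_of_nonpos (a := w - z) (by linarith)] at h
    exact ⟨fun _ => h0, fun _ => by linarith⟩
  · rw [abs_of_pos (a := w - z) (by linarith)] at h
    exact ⟨fun _ => by linarith, fun _ => by linarith⟩

lemma abs_steinDeriv_sub_le_of_abs_lt {z w t s : ℝ} (h : |t| < |w - z|) (hs : |s| ≤ |t|) :
    |steinDeriv z (w + s) - steinDeriv z w| ≤ |s| * (2 + 3 * |w|) := by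
  have := abs_mul_steinSol_sub_le z w s
  simp only [steinDeriv, le_iff_of_abs_lt h hs]
  convert this using 2
  ring

lemma abs_steinDeriv_sub_le (z w t : ℝ) :
    |steinDeriv z (w + t) - steinDeriv z w| ≤ |t| * (2 + 3 * |w|) + nearKink z w t := by
  unfold nearKink
  split_ifs with h
  · have h1 := abs_le.1 (abs_mul_steinSol_sub_le z w t)
    unfold steinDeriv
    rw [abs_le]
    split_ifs <;> constructor <;> linarith
  · simpa using abs_steinDeriv_sub_le_of_abs_lt (not_le.1 h) le_rfl

/-- First-order Taylor expansion of the Stein solution. Away from the kink the remainder is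
quadratic; near it only the trivial bound is available. -/
lemma abs_steinSol_taylor_le (z w t : ℝ) :
    |steinSol z (w + t) - steinSol z w - t * steinDeriv z w| ≤
      |t| ^ 2 * (2 + 3 * |w|) + 6 * |t| * nearKink z w t := by
  unfold nearKink
  split_ifs with h
  · have h2 := abs_steinSol_sub_le z w (w + t)
    rw [add_sub_cancel_left] at h2
    have h3 : |t * steinDeriv z w| ≤ |t| * 3 := by
      rw [abs_mul]; gcongr; exact abs_steinDeriv_le z w
    have h4 := abs_sub (steinSol z (w + t) - steinSol z w) (t * steinDeriv z w)
    have h5 : 0 ≤ |t| ^ 2 * (2 + 3 * |w|) := by positivity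
    linarith
  · have h := not_le.1 h
    have hmem {s : ℝ} (hs : s ∈ Set.uIcc 0 t) : |s| ≤ |t| := by
      simpa using Set.abs_sub_left_of_mem_uIcc hs
    have h1 : ∀ s ∈ Set.uIcc 0 t, HasDerivWithinAt
        (fun s => steinSol z (w + s) - s * steinDeriv z w)
        (steinDeriv z (w + s) - steinDeriv z w) (Set.uIcc 0 t) s := by
      intro s hs
      have hne : w + s ≠ z := by
        intro h0
        have : |s| = |w - z| := by rw [← h0, abs_sub_comm]; simp
        linarith [hmem hs]
      have h2 : HasDerivAt (fun s => steinSol z (w + s)) (steinDeriv z (w + s)) s :=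
        (hasDerivAt_steinSol hne).comp_const_add w s
      have h3 := (hasDerivAt_id s).mul_const (steinDeriv z w)
      exact ((h2.sub h3).congr_deriv (by simp)).hasDerivWithinAt
    have h2 : ∀ s ∈ Set.uIcc 0 t,
        ‖steinDeriv z (w + s) - steinDeriv z w‖ ≤ |t| * (2 + 3 * |w|) := fun s hs =>
      (abs_steinDeriv_sub_le_of_abs_lt h (hmem hs)).trans
        (mul_le_mul_of_nonneg_right (hmem hs) (by positivity))
    have h3 := (convex_uIcc (0 : ℝ) t).norm_image_sub_le_of_norm_hasDerivWithin_le h1 h2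
      Set.left_mem_uIcc Set.right_mem_uIcc
    simp only [add_zero, zero_mul, sub_zero, Real.norm_eq_abs] at h3
    rw [mul_zero, add_zero]
    calc _ = |steinSol z (w + t) - t * steinDeriv z w - steinSol z w| := by congr 1; ring
      _ ≤ _ := h3
      _ = _ := by ring

/-! ### A Berry–Esseen inequality by Stein's method -/

/-- Independent centered real random variables with finite third absolute moments. -/
structure IsCenteredIndep {Ω ι : Type*} [MeasurableSpace Ω] (P : Measure Ω)
    (X : ι → Ω → ℝ) : Prop where
  measurable : ∀ i, Measurable (X i)
  indep : iIndepFun X P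
  integrable_abs_cube : ∀ i, Integrable (fun ω => |X i ω| ^ 3) P
  centered : ∀ i, ∫ ω, X i ω ∂P = 0

namespace IsCenteredIndep

variable {Ω ι : Type*} [MeasurableSpace Ω] {P : Measure Ω} {X : ι → Ω → ℝ}

lemma measurable_sum (h : IsCenteredIndep P X) (s : Finset ι) :
    Measurable (fun ω => ∑ j ∈ s, X j ω) :=
  Finset.measurable_sum s fun j _ => h.measurable j

lemma indepFun_sum (h : IsCenteredIndep P X) {s : Finset ι} {i : ι} (hi : i ∉ s) :
    IndepFun (X i) (fun ω => ∑ j ∈ s, X j ω) P := by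
  have := (h.indep.indepFun_finsetSum_of_notMem h.measurable hi).symm
  convert this using 1
  ext ω
  simp

variable [IsProbabilityMeasure P]

lemma integrable_sq (h : IsCenteredIndep P X) (i : ι) : Integrable (fun ω => X i ω ^ 2) P := by
  refine ((h.integrable_abs_cube i).add (integrable_const 1)).mono'
    ((h.measurable i).pow_const 2).aestronglyMeasurable (Eventually.of_forall fun ω => ?_)
  have := abs_nonneg (X i ω)
  simp only [Real.norm_eq_abs, abs_pow, Pi.add_apply]
  rcases le_total |X i ω| 1 with h1 | h1
  · nlinarith [pow_nonneg this 3]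
  · nlinarith [pow_nonneg this 2]

lemma memLp_two (h : IsCenteredIndep P X) (i : ι) : MemLp (X i) 2 P :=
  (memLp_two_iff_integrable_sq (h.measurable i).aestronglyMeasurable).2 (h.integrable_sq i)

lemma integrable (h : IsCenteredIndep P X) (i : ι) : Integrable (X i) P :=
  (h.memLp_two i).integrable one_le_two

lemma memLp_sum (h : IsCenteredIndep P X) (s : Finset ι) :
    MemLp (fun ω => ∑ j ∈ s, X j ω) 2 P :=
  memLp_finsetSum s fun j _ => h.memLp_two j

lemma integral_sum_sq (h : IsCenteredIndep P X) (s : Finset ι) :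
    ∫ ω, (∑ j ∈ s, X j ω) ^ 2 ∂P = ∑ j ∈ s, ∫ ω, X j ω ^ 2 ∂P := by
  have h1 := IndepFun.variance_sum (s := s) (fun i _ => h.memLp_two i)
    (fun i _ j _ hij => h.indep.indepFun hij)
  have h2 : ∀ i, variance (X i) P = ∫ ω, X i ω ^ 2 ∂P := fun i =>
    variance_of_integral_eq_zero (h.measurable i).aemeasurable (h.centered i)
  have h3 : ∑ i ∈ s, X i = fun ω => ∑ j ∈ s, X j ω := by ext ω; simp
  rw [h3, variance_of_integral_eq_zero (h.measurable_sum s).aemeasurable] at h1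
  · simpa [h2] using h1
  · rw [integral_finsetSum _ fun j _ => h.integrable j]
    simp [h.centered]

lemma integral_abs_sum_le_one (h : IsCenteredIndep P X) {s : Finset ι}
    (hs : ∑ j ∈ s, ∫ ω, X j ω ^ 2 ∂P ≤ 1) : ∫ ω, |∑ j ∈ s, X j ω| ∂P ≤ 1 := by
  have hi := (h.memLp_sum s).integrable_sq
  have h1 : ∫ ω, |∑ j ∈ s, X j ω| ∂P ≤ ∫ ω, (1 / 2 + (∑ j ∈ s, X j ω) ^ 2 / 2) ∂P := by
    refine integral_mono ((h.memLp_sum s).integrable one_le_two).abs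
      ((integrable_const _).add (hi.div_const 2)) fun ω => ?_
    have := sq_abs (∑ j ∈ s, X j ω)
    nlinarith [sq_nonneg (|∑ j ∈ s, X j ω| - 1)]
  rw [integral_add (integrable_const _) (hi.div_const 2), integral_div 2 (fun ω => _ ^ 2),
    h.integral_sum_sq] at h1
  simp at h1
  linarith

/-- Lyapunov's inequality `(E X²) ^ (3/2) ≤ E |X|³`, with `a = √(E X²)`. -/
lemma pow_three_le (h : IsCenteredIndep P X) (i : ι) {a : ℝ} (ha : 0 ≤ a)
    (has : a ^ 2 = ∫ ω, X i ω ^ 2 ∂P) : a ^ 3 ≤ ∫ ω, |X i ω| ^ 3 ∂P := by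
  have h1 : ∫ ω, (3 / 2 * a * X i ω ^ 2 - a ^ 3 / 2) ∂P ≤ ∫ ω, |X i ω| ^ 3 ∂P := by
    refine integral_mono (((h.integrable_sq i).const_mul _).sub (integrable_const _))
      (h.integrable_abs_cube i) fun ω => ?_
    have h0 := abs_nonneg (X i ω)
    have := sq_abs (X i ω)
    simp only
    rw [← this]
    nlinarith [mul_nonneg (add_nonneg h0 (half_pos one_pos).le) (sq_nonneg (|X i ω| - a)),
      mul_nonneg h0 (sq_nonneg (|X i ω| - a)), mul_nonneg ha (sq_nonneg (|X i ω| - a))]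
  rw [integral_sub ((h.integrable_sq i).const_mul _) (integrable_const _), integral_const_mul,
    ← has] at h1
  simp at h1
  linarith

/-- The correlation inequality `E X² E |X| ≤ E |X|³`, from `(|X| - a) (X² - a²) ≥ 0` with
`a = √(E X²)`. -/
lemma integral_sq_mul_integral_abs_le (h : IsCenteredIndep P X) (i : ι) :
    (∫ ω, X i ω ^ 2 ∂P) * ∫ ω, |X i ω| ∂P ≤ ∫ ω, |X i ω| ^ 3 ∂P := by
  have hs : 0 ≤ ∫ ω, X i ω ^ 2 ∂P := integral_nonneg fun _ => sq_nonneg _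
  set a := √(∫ ω, X i ω ^ 2 ∂P) with ha
  have ha0 : 0 ≤ a := Real.sqrt_nonneg _
  have has : a ^ 2 = ∫ ω, X i ω ^ 2 ∂P := Real.sq_sqrt hs
  have hi : Integrable (fun ω => a * X i ω ^ 2 - a ^ 3) P :=
    ((h.integrable_sq i).const_mul _).sub (integrable_const _)
  have h1 : ∫ ω, (a ^ 2 * |X i ω| + (a * X i ω ^ 2 - a ^ 3)) ∂P ≤ ∫ ω, |X i ω| ^ 3 ∂P := by
    refine integral_mono (((h.integrable i).abs.const_mul _).add hi)
      (h.integrable_abs_cube i) fun ω => ?_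
    have h0 := abs_nonneg (X i ω)
    have := sq_abs (X i ω)
    simp only
    rw [← this]
    nlinarith [mul_nonneg (add_nonneg h0 ha0) (sq_nonneg (|X i ω| - a))]
  rw [integral_add ((h.integrable i).abs.const_mul _) hi,
    integral_sub ((h.integrable_sq i).const_mul _) (integrable_const _), integral_const_mul,
    integral_const_mul, ← has] at h1
  simp at h1
  rw [← has]
  nlinarith

end IsCenteredIndep

/-- A clamp function, centered so as to be odd about the midpoint of `[a, b]`, that
increases at unit speed on the `γ`-neighbourhood of `[a, b]`. -/
noncomputable def concClamp (a b γ w : ℝ) : ℝ := max (a - γ) (min w (b + γ)) - (a + b) / 2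

lemma abs_concClamp_le {a b γ : ℝ} (hab : a ≤ b) (hγ : 0 ≤ γ) (w : ℝ) :
    |concClamp a b γ w| ≤ (b - a) / 2 + γ := by
  unfold concClamp
  rw [abs_le]
  rcases max_cases (a - γ) (min w (b + γ)) with h | h <;>
  rcases min_cases w (b + γ) with h' | h' <;> constructor <;> linarith

lemma concClamp_mono (a b γ : ℝ) : Monotone (concClamp a b γ) := fun u v h => by
  unfold concClamp
  gcongr

lemma le_mul_concClamp_sub {a b γ : ℝ} (hγ : 0 ≤ γ) (w x : ℝ) :
    (Set.Icc a b).indicator (fun _ => |x| * min |x| γ) w ≤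
      x * (concClamp a b γ w - concClamp a b γ (w - x)) := by
  by_cases hw : w ∈ Set.Icc a b
  · obtain ⟨h1, h2⟩ := hw
    rw [Set.indicator_of_mem (Set.mem_Icc.2 ⟨h1, h2⟩)]
    have e1 : concClamp a b γ w = w - (a + b) / 2 := by
      rw [concClamp, min_eq_left (by linarith), max_eq_right (by linarith)]
    rw [e1, concClamp]
    rcases le_total 0 x with hx | hx
    · rw [abs_of_nonneg hx, min_eq_left (a := w - x) (by linarith)]
      refine mul_le_mul_of_nonneg_left ?_ hx
      rcases max_cases (a - γ) (w - x) with h | h <;> rcases min_cases x γ with h' | h' <;> linarith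
    · rw [abs_of_nonpos hx, max_eq_right (le_min (by linarith) (by linarith)), neg_mul,
        ← mul_neg]
      refine mul_le_mul_of_nonpos_left ?_ hx
      rcases min_cases (w - x) (b + γ) with h | h <;> rcases min_cases (-x) γ with h' | h' <;>
        linarith
  · rw [Set.indicator_of_notMem hw]
    rcases le_total 0 x with hx | hx
    · exact mul_nonneg hx (sub_nonneg.2 (concClamp_mono a b γ (by linarith)))
    · exact mul_nonneg_of_nonpos_of_nonpos hx
        (sub_nonpos.2 (concClamp_mono a b γ (by linarith)))

lemma sub_div_le_abs_mul_min {γ : ℝ} (hγ : 0 < γ) (x : ℝ) :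
    x ^ 2 - |x| ^ 3 / (4 * γ) ≤ |x| * min |x| γ := by
  rw [← sq_abs, sub_le_iff_le_add, ← sub_le_iff_le_add', le_div_iff₀ (by positivity)]
  have h0 := abs_nonneg x
  rcases min_cases |x| γ with ⟨h, _⟩ | ⟨h, h'⟩
  · rw [h]; nlinarith [pow_nonneg h0 3]
  · rw [h]; nlinarith [mul_nonneg h0 (sq_nonneg (|x| - 2 * γ))]

namespace IsCenteredIndep

variable {Ω ι : Type*} [MeasurableSpace Ω] {P : Measure Ω} [IsProbabilityMeasure P]
  {X : ι → Ω → ℝ}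

/-- For bounded `F`, `E [X_j F(T)] = E [X_j (F(T) - F(T - X_j))]`, because `X_j` is centered and
independent of `T - X_j`. -/
lemma integral_mul_comp_sum [DecidableEq ι] (h : IsCenteredIndep P X) {s : Finset ι} {j : ι}
    {F : ℝ → ℝ} (hF : Measurable F) {c : ℝ} (hc : ∀ w, |F w| ≤ c) :
    ∫ ω, X j ω * F (∑ k ∈ s, X k ω) ∂P =
      ∫ ω, X j ω * (F (∑ k ∈ s, X k ω) - F (∑ k ∈ s.erase j, X k ω)) ∂P := by
  have hi (t : Finset ι) : Integrable (fun ω => X j ω * F (∑ k ∈ t, X k ω)) P :=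
    (h.integrable j).mul_bdd (c := c) (hF.comp (h.measurable_sum t)).aestronglyMeasurable
      (Eventually.of_forall fun ω => hc _)
  have h0 : ∫ ω, X j ω * F (∑ k ∈ s.erase j, X k ω) ∂P = 0 := by
    have := (h.indepFun_sum (s.notMem_erase j)).integral_fun_comp_mul_comp
      (f := id) (g := F) (h.measurable j).aemeasurable (h.measurable_sum _).aemeasurable
      measurable_id.aestronglyMeasurable hF.aestronglyMeasurable
    simpa [h.centered] using this
  simp_rw [mul_sub]
  rw [integral_sub (hi _) (hi _), h0, sub_zero]

/-- The concentration inequality: a sum with variance bounded below spreads its mass, up to the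
third moments. With `F` the clamp function, `E [T F(T)]` is at most `sup |F|` and at least half
of the probability in question, minus `γ`. -/
lemma concentration (h : IsCenteredIndep P X) {s : Finset ι} {γ : ℝ} (hγ : 0 < γ)
    (hv : 3 / 4 ≤ ∑ j ∈ s, ∫ ω, X j ω ^ 2 ∂P) (hv1 : ∑ j ∈ s, ∫ ω, X j ω ^ 2 ∂P ≤ 1)
    (h3 : ∑ j ∈ s, ∫ ω, |X j ω| ^ 3 ∂P ≤ γ) {a b : ℝ} (hab : a ≤ b) :
    P.real {ω | ∑ j ∈ s, X j ω ∈ Set.Icc a b} ≤ (b - a) + 4 * γ := by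
  classical
  set T : Ω → ℝ := fun ω => ∑ j ∈ s, X j ω with hT
  have hTm : Measurable T := h.measurable_sum s
  set F := concClamp a b γ with hF
  have hFm : Measurable F := (concClamp_mono a b γ).measurable
  have hFb := abs_concClamp_le hab hγ.le
  set A : Set Ω := {ω | T ω ∈ Set.Icc a b} with hA
  have hAm : MeasurableSet A := hTm measurableSet_Icc
  -- `Y j` is the truncated square of `X j`
  set Y : ι → Ω → ℝ := fun j ω => |X j ω| * min |X j ω| γ with hY
  have hφm : Measurable (fun x : ℝ => |x| * min |x| γ) := by fun_prop
  have hYm : ∀ j, Measurable (Y j) := fun j => hφm.comp (h.measurable j)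
  have hYb : ∀ j ω, |Y j ω| ≤ γ * |X j ω| := fun j ω => by
    have := abs_nonneg (X j ω)
    rw [hY, abs_of_nonneg (mul_nonneg this (le_min this hγ.le)), mul_comm]
    exact mul_le_mul_of_nonneg_right (min_le_right _ _) this
  have hY2 : ∀ j, MemLp (Y j) 2 P := fun j =>
    ((h.memLp_two j).const_mul γ).mono (hYm j).aestronglyMeasurable
      (Eventually.of_forall fun ω => by
        simpa [abs_mul, abs_of_pos hγ] using hYb j ω)
  have hYi : ∀ j, Integrable (Y j) P := fun j => (hY2 j).integrable one_le_two
  set η : Ω → ℝ := fun ω => ∑ j ∈ s, Y j ω with hη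
  have hη2 : MemLp η 2 P := memLp_finsetSum s fun j _ => hY2 j
  have hηi : Integrable η P := hη2.integrable one_le_two
  set m := ∫ ω, η ω ∂P with hm
  -- the variance of `η` is at most `γ²`
  have hvar : variance η P ≤ γ ^ 2 := by
    have e : η = ∑ j ∈ s, Y j := by ext ω; simp [hη]
    rw [e, IndepFun.variance_sum (fun j _ => hY2 j) (fun i _ j _ hij => by
      exact (h.indep.indepFun hij).comp hφm hφm)]
    calc ∑ j ∈ s, variance (Y j) P ≤ ∑ j ∈ s, γ ^ 2 * ∫ ω, X j ω ^ 2 ∂P := by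
          refine Finset.sum_le_sum fun j _ => ?_
          refine (variance_le_expectation_sq (hYm j).aestronglyMeasurable).trans ?_
          rw [← integral_const_mul]
          refine integral_mono (hY2 j).integrable_sq ((h.integrable_sq j).const_mul _) fun ω => ?_
          have := pow_le_pow_left₀ (abs_nonneg _) (hYb j ω) 2
          simpa [mul_pow] using this
      _ ≤ γ ^ 2 := by
          rw [← Finset.mul_sum]
          nlinarith [sq_nonneg γ]
  have hdev : ∫ ω, |η ω - m| ∂P ≤ γ := by
    have hd : MemLp (fun ω => η ω - m) 2 P := hη2.sub (memLp_const m)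
    have h1 : ∫ ω, |η ω - m| ∂P ≤ ∫ ω, (γ / 2 + (η ω - m) ^ 2 / (2 * γ)) ∂P := by
      refine integral_mono (hd.integrable one_le_two).abs
        ((integrable_const _).add (hd.integrable_sq.div_const _)) fun ω => ?_
      simp only
      rw [div_add_div _ _ (by norm_num) (by positivity), le_div_iff₀ (by positivity),
        ← sq_abs (η ω - m)]
      nlinarith [sq_nonneg (|η ω - m| - γ)]
    rw [integral_add (integrable_const _) (hd.integrable_sq.div_const _),
      integral_div _ (fun ω => _ ^ 2),
      ← variance_eq_integral hη2.aestronglyMeasurable.aemeasurable] at h1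
    have h2 : variance η P / (2 * γ) ≤ γ / 2 := by
      rw [div_le_iff₀ (by positivity)]; nlinarith
    simp at h1
    linarith
  have hmean : 1 / 2 ≤ m := by
    have h1 : ∑ j ∈ s, ((∫ ω, X j ω ^ 2 ∂P) - (∫ ω, |X j ω| ^ 3 ∂P) / (4 * γ)) ≤ m := by
      rw [hm, hη, integral_finsetSum _ fun j _ => hYi j]
      refine Finset.sum_le_sum fun j _ => ?_
      rw [← integral_div,
        ← integral_sub (h.integrable_sq j) ((h.integrable_abs_cube j).div_const _)]
      exact integral_mono ((h.integrable_sq j).sub ((h.integrable_abs_cube j).div_const _))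
        (hYi j) fun ω => sub_div_le_abs_mul_min hγ _
    rw [Finset.sum_sub_distrib, ← Finset.sum_div] at h1
    have h2 : (∑ j ∈ s, ∫ ω, |X j ω| ^ 3 ∂P) / (4 * γ) ≤ 1 / 4 := by
      rw [div_le_iff₀ (by positivity)]; linarith
    linarith
  -- `E [T F(T)]` from above
  have hTi : Integrable T P := (h.memLp_sum s).integrable one_le_two
  have hXF (j : ι) : Integrable (fun ω => X j ω * F (T ω)) P :=
    (h.integrable j).mul_bdd (c := (b - a) / 2 + γ) (hFm.comp hTm).aestronglyMeasurable
      (Eventually.of_forall fun ω => hFb _)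
  have hup : ∑ j ∈ s, ∫ ω, X j ω * F (T ω) ∂P ≤ (b - a) / 2 + γ := by
    rw [← integral_finsetSum _ fun j _ => hXF j]
    calc ∫ ω, ∑ j ∈ s, X j ω * F (T ω) ∂P ≤ ∫ ω, ((b - a) / 2 + γ) * |T ω| ∂P := by
          refine integral_mono (integrable_finsetSum _ fun j _ => hXF j) (hTi.abs.const_mul _)
            fun ω => ?_
          simp only
          rw [← Finset.sum_mul]
          calc T ω * F (T ω) ≤ |T ω| * |F (T ω)| := by rw [← abs_mul]; exact le_abs_self _
            _ ≤ |T ω| * ((b - a) / 2 + γ) := by gcongr; exact hFb _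
            _ = _ := mul_comm _ _
      _ ≤ ((b - a) / 2 + γ) * 1 := by
          rw [integral_const_mul]
          exact mul_le_mul_of_nonneg_left (h.integral_abs_sum_le_one hv1) (by linarith)
      _ = _ := mul_one _
  -- `E [T F(T)]` from below
  have hdi : Integrable (fun ω => |η ω - m|) P := (hηi.sub (integrable_const m)).abs
  have hlow : m * P.real A - γ ≤ ∑ j ∈ s, ∫ ω, X j ω * F (T ω) ∂P := by
    calc m * P.real A - γ ≤ ∫ ω, (A.indicator (fun _ => m) ω - |η ω - m|) ∂P := by
          rw [integral_sub ((integrable_const _).indicator hAm) hdi, integral_indicator_const _ hAm,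
            smul_eq_mul, mul_comm]
          linarith
      _ ≤ ∫ ω, ∑ j ∈ s, A.indicator (Y j) ω ∂P := by
          refine integral_mono (((integrable_const _).indicator hAm).sub hdi)
            (integrable_finsetSum _ fun j _ => (hYi j).indicator hAm) fun ω => ?_
          by_cases hω : ω ∈ A
          · simp only [Set.indicator_of_mem hω]
            have := neg_abs_le (η ω - m)
            change m - |η ω - m| ≤ η ω
            linarith
          · simp [Set.indicator_of_notMem hω]
      _ = ∑ j ∈ s, ∫ ω, A.indicator (Y j) ω ∂P :=
          integral_finsetSum _ fun j _ => (hYi j).indicator hAm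
      _ ≤ ∑ j ∈ s, ∫ ω, X j ω * F (T ω) ∂P := by
          refine Finset.sum_le_sum fun j hj => ?_
          rw [h.integral_mul_comp_sum hFm hFb]
          have hXF' : Integrable (fun ω => X j ω * F (∑ k ∈ s.erase j, X k ω)) P :=
            (h.integrable j).mul_bdd (c := (b - a) / 2 + γ)
              (hFm.comp (h.measurable_sum _)).aestronglyMeasurable
              (Eventually.of_forall fun ω => hFb _)
          refine integral_mono ((hYi j).indicator hAm) ?_ fun ω => ?_
          · simp_rw [mul_sub]
            exact (hXF j).sub hXF'
          · have e : ∑ k ∈ s.erase j, X k ω = T ω - X j ω := by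
              simp only [hT]
              rw [← Finset.add_sum_erase s (fun k => X k ω) hj]; ring
            have := le_mul_concClamp_sub (a := a) (b := b) hγ.le (T ω) (X j ω)
            simp only
            rw [e]
            exact this
  nlinarith

end IsCenteredIndep

lemma measurable_nearKink (z : ℝ) : Measurable (fun p : ℝ × ℝ => nearKink z p.2 p.1) := by
  unfold nearKink
  exact Measurable.ite (measurableSet_le (by fun_prop) (by fun_prop)) measurable_const
    measurable_const

/-- Conditioning on `X` turns a concentration bound for `Y`, independent of `X`, into a bound for
the probability that `Y` lies within the random distance `|X|` of `z`. -/
lemma integral_mul_nearKink_le {Ω : Type*} [MeasurableSpace Ω] {P : Measure Ω}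
    [IsProbabilityMeasure P] {X Y : Ω → ℝ} (hX : Measurable X) (hY : Measurable Y)
    (hXY : IndepFun X Y P) {g : ℝ → ℝ} (hg : Measurable g) (hg0 : ∀ x, 0 ≤ g x)
    (hgi : Integrable (fun ω => g (X ω)) P) (hgXi : Integrable (fun ω => g (X ω) * |X ω|) P)
    {z κ : ℝ} (hconc : ∀ t, 0 ≤ t → P.real {ω | Y ω ∈ Set.Icc (z - t) (z + t)} ≤ 2 * t + κ) :
    ∫ ω, g (X ω) * nearKink z (Y ω) (X ω) ∂P ≤
      2 * (∫ ω, g (X ω) * |X ω| ∂P) + κ * ∫ ω, g (X ω) ∂P := by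
  have hm := hX.prodMk hY
  have hF : Measurable (fun p : ℝ × ℝ => g p.1 * nearKink z p.2 p.1) :=
    (hg.comp measurable_fst).mul (measurable_nearKink z)
  have hFi : Integrable (fun ω => g (X ω) * nearKink z (Y ω) (X ω)) P :=
    hgi.mul_bdd (c := 1) ((measurable_nearKink z).comp hm).aestronglyMeasurable
      (Eventually.of_forall fun ω => by
        rw [Real.norm_eq_abs, abs_of_nonneg (nearKink_nonneg _ _ _)]
        exact nearKink_le_one _ _ _)
  have hlaw := (indepFun_iff_map_prod_eq_prod_map_map hX.aemeasurable hY.aemeasurable).1 hXY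
  have := Measure.isProbabilityMeasure_map (μ := P) hX.aemeasurable
  have := Measure.isProbabilityMeasure_map (μ := P) hY.aemeasurable
  have hFi' : Integrable (fun p : ℝ × ℝ => g p.1 * nearKink z p.2 p.1)
      ((P.map X).prod (P.map Y)) := by
    rw [← hlaw, integrable_map_measure hF.aestronglyMeasurable hm.aemeasurable]
    exact hFi
  have e1 : ∫ ω, g (X ω) * nearKink z (Y ω) (X ω) ∂P =
      ∫ x, ∫ y, g x * nearKink z y x ∂(P.map Y) ∂(P.map X) := by
    rw [← integral_prod _ hFi', ← hlaw, integral_map hm.aemeasurable hF.aestronglyMeasurable]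
  have hgi' : Integrable (fun x => κ * g x) (P.map X) := by
    refine Integrable.const_mul ?_ κ
    rw [integrable_map_measure hg.aestronglyMeasurable hX.aemeasurable]
    exact hgi
  have hgm : Measurable (fun x => g x * |x|) := by fun_prop
  have hgXi' : Integrable (fun x => 2 * (g x * |x|)) (P.map X) := by
    refine Integrable.const_mul ?_ 2
    rw [integrable_map_measure hgm.aestronglyMeasurable hX.aemeasurable]
    exact hgXi
  have e2 : 2 * (∫ ω, g (X ω) * |X ω| ∂P) + κ * ∫ ω, g (X ω) ∂P =
      ∫ x, (2 * (g x * |x|) + κ * g x) ∂(P.map X) := by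
    rw [integral_add hgXi' hgi', integral_const_mul, integral_const_mul,
      integral_map hX.aemeasurable hgm.aestronglyMeasurable,
      integral_map hX.aemeasurable hg.aestronglyMeasurable]
  rw [e1, e2]
  refine integral_mono hFi'.integral_prod_left (hgXi'.add hgi') fun x => ?_
  have e3 : ∫ y, nearKink z y x ∂(P.map Y) = P.real {ω | Y ω ∈ Set.Icc (z - |x|) (z + |x|)} := by
    have : (fun y => nearKink z y x) = (Set.Icc (z - |x|) (z + |x|)).indicator 1 := by
      ext y
      unfold nearKink
      rw [Set.indicator_apply]
      refine if_congr ?_ rfl rfl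
      rw [abs_le, Set.mem_Icc]
      constructor <;> rintro ⟨h1, h2⟩ <;> constructor <;> linarith
    rw [this, integral_indicator_one measurableSet_Icc, map_measureReal_apply hY measurableSet_Icc]
    rfl
  simp only
  rw [integral_const_mul, e3]
  calc _ ≤ g x * (2 * |x| + κ) := mul_le_mul_of_nonneg_left (hconc _ (abs_nonneg x)) (hg0 x)
    _ = _ := by ring

namespace IsCenteredIndep

variable {Ω ι : Type*} [MeasurableSpace Ω] {P : Measure Ω} [IsProbabilityMeasure P]
  {X : ι → Ω → ℝ}

/-- The contribution of one summand to Stein's identity: with `U` the sum of the other summands,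
`E [X f(U + X)] = E X² E f'(U + X)` up to third moments. -/
lemma abs_integral_mul_steinSol_sub_le [DecidableEq ι] (h : IsCenteredIndep P X) {s : Finset ι}
    {i : ι} (hi : i ∈ s) {γ : ℝ} (z : ℝ)
    (hU1 : ∫ ω, |∑ j ∈ s.erase i, X j ω| ∂P ≤ 1)
    (hconc : ∀ t, 0 ≤ t →
      P.real {ω | ∑ j ∈ s.erase i, X j ω ∈ Set.Icc (z - t) (z + t)} ≤ 2 * t + 4 * γ) :
    |(∫ ω, X i ω * steinSol z (∑ j ∈ s, X j ω) ∂P) -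
        (∫ ω, X i ω ^ 2 ∂P) * ∫ ω, steinDeriv z (∑ j ∈ s, X j ω) ∂P| ≤
      24 * (∫ ω, |X i ω| ^ 3 ∂P) + 28 * γ * ∫ ω, X i ω ^ 2 ∂P := by
  set U : Ω → ℝ := fun ω => ∑ j ∈ s.erase i, X j ω with hU
  set v := ∫ ω, X i ω ^ 2 ∂P with hv
  have hv0 : 0 ≤ v := integral_nonneg fun _ => sq_nonneg _
  set β := ∫ ω, |X i ω| ^ 3 ∂P with hβ
  have hWU : ∀ ω, ∑ j ∈ s, X j ω = U ω + X i ω := fun ω => by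
    rw [hU, ← Finset.add_sum_erase s (fun k => X k ω) hi, add_comm]
  have hUm : Measurable U := h.measurable_sum _
  have hXm := h.measurable i
  have hUi : Integrable (fun ω => |U ω|) P := ((h.memLp_sum _).integrable one_le_two).abs
  have hind : IndepFun (X i) U P := h.indepFun_sum (s.notMem_erase i)
  have hfm := (continuous_steinSol z).measurable
  have hdm := measurable_steinDeriv z
  have hkm : Measurable (fun ω => nearKink z (U ω) (X i ω)) :=
    (measurable_nearKink z).comp (hXm.prodMk hUm)
  have hkb : ∀ ω, ‖nearKink z (U ω) (X i ω)‖ ≤ 1 := fun ω => by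
    rw [Real.norm_eq_abs, abs_of_nonneg (nearKink_nonneg _ _ _)]
    exact nearKink_le_one _ _ _
  have hX1 : Integrable (fun ω => |X i ω|) P := (h.integrable i).abs
  have hX2 := h.integrable_sq i
  have hX3 := h.integrable_abs_cube i
  -- the error terms: third moments, and the probability that `U` is near the kink
  have hE1i : Integrable (fun ω => |X i ω| ^ 3 * (2 + 3 * |U ω|)) P := by
    have := (hind.comp (φ := fun x => |x| ^ 3) (ψ := fun u => 2 + 3 * |u|)
      (by fun_prop) (by fun_prop)).integrable_mul hX3 ((integrable_const _).add (hUi.const_mul _))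
    exact this
  have hU5 : ∫ ω, (2 + 3 * |U ω|) ∂P ≤ 5 := by
    rw [integral_add (integrable_const _) (hUi.const_mul _), integral_const_mul]
    simp
    linarith
  have hE1 : ∫ ω, |X i ω| ^ 3 * (2 + 3 * |U ω|) ∂P ≤ 5 * β := by
    have := hind.integral_fun_comp_mul_comp (f := fun x => |x| ^ 3) (g := fun u => 2 + 3 * |u|)
      hXm.aemeasurable hUm.aemeasurable (by fun_prop) (by fun_prop)
    rw [this, mul_comm]
    exact mul_le_mul_of_nonneg_right hU5 (integral_nonneg fun _ => by positivity)
  have hE2i : Integrable (fun ω => |X i ω| * (2 + 3 * |U ω|)) P := by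
    have := (hind.comp (φ := fun x => |x|) (ψ := fun u => 2 + 3 * |u|)
      (by fun_prop) (by fun_prop)).integrable_mul hX1 ((integrable_const _).add (hUi.const_mul _))
    exact this
  have hE2 : v * ∫ ω, |X i ω| * (2 + 3 * |U ω|) ∂P ≤ 5 * β := by
    have := hind.integral_fun_comp_mul_comp (f := fun x => |x|) (g := fun u => 2 + 3 * |u|)
      hXm.aemeasurable hUm.aemeasurable (by fun_prop) (by fun_prop)
    rw [this, ← mul_assoc, mul_comm]
    have h1 : 0 ≤ ∫ ω, |X i ω| ∂P := integral_nonneg fun _ => by positivity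
    exact mul_le_mul hU5 (h.integral_sq_mul_integral_abs_le i) (mul_nonneg hv0 h1) (by norm_num)
  have hE3i : Integrable (fun ω => X i ω ^ 2 * nearKink z (U ω) (X i ω)) P :=
    hX2.mul_bdd hkm.aestronglyMeasurable (Eventually.of_forall hkb)
  have hE3 : ∫ ω, X i ω ^ 2 * nearKink z (U ω) (X i ω) ∂P ≤ 2 * β + 4 * γ * v := by
    have e : ∀ x : ℝ, x ^ 2 * |x| = |x| ^ 3 := fun x => by rw [← sq_abs]; ring
    have := integral_mul_nearKink_le hXm hUm hind (g := fun x => x ^ 2) (by fun_prop)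
      (fun x => sq_nonneg x) hX2 (by simpa only [e] using hX3) hconc
    simpa only [e] using this
  have hE4i : Integrable (fun ω => nearKink z (U ω) (X i ω)) P :=
    Integrable.of_bound hkm.aestronglyMeasurable 1 (Eventually.of_forall hkb)
  have hE4 : v * ∫ ω, nearKink z (U ω) (X i ω) ∂P ≤ 2 * β + 4 * γ * v := by
    have := integral_mul_nearKink_le hXm hUm hind (g := fun _ => 1) (by fun_prop)
      (fun x => zero_le_one) (integrable_const _) (by simpa using hX1) hconc
    simp at this
    have h1 := mul_le_mul_of_nonneg_left this hv0
    have h2 := h.integral_sq_mul_integral_abs_le i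
    nlinarith
  -- both expectations are compared with `E X² E f'(U)`, which factorizes by independence
  have hbd : ∀ w, ‖steinDeriv z w‖ ≤ 3 := abs_steinDeriv_le z
  have hbf : ∀ w, ‖steinSol z w‖ ≤ 2 := abs_steinSol_le z
  have hD : Integrable (fun ω => steinDeriv z (U ω)) P :=
    Integrable.of_bound (hdm.comp hUm).aestronglyMeasurable 3 (Eventually.of_forall fun _ => hbd _)
  have hDW : Integrable (fun ω => steinDeriv z (U ω + X i ω)) P :=
    Integrable.of_bound (hdm.comp (hUm.add hXm)).aestronglyMeasurable 3
      (Eventually.of_forall fun _ => hbd _)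
  have hXD : Integrable (fun ω => X i ω ^ 2 * steinDeriv z (U ω)) P :=
    hX2.mul_bdd (hdm.comp hUm).aestronglyMeasurable (Eventually.of_forall fun _ => hbd _)
  have hXf : Integrable (fun ω => X i ω * steinSol z (U ω + X i ω)) P :=
    (h.integrable i).mul_bdd (hfm.comp (hUm.add hXm)).aestronglyMeasurable
      (Eventually.of_forall fun _ => hbf _)
  have hXfU : Integrable (fun ω => X i ω * steinSol z (U ω)) P :=
    (h.integrable i).mul_bdd (hfm.comp hUm).aestronglyMeasurable
      (Eventually.of_forall fun _ => hbf _)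
  have hXff : Integrable
      (fun ω => X i ω * steinSol z (U ω + X i ω) - X i ω * steinSol z (U ω)) P := hXf.sub hXfU
  have hprod : ∫ ω, X i ω ^ 2 * steinDeriv z (U ω) ∂P = v * ∫ ω, steinDeriv z (U ω) ∂P :=
    hind.integral_fun_comp_mul_comp (f := fun x => x ^ 2) (g := steinDeriv z)
      hXm.aemeasurable hUm.aemeasurable (by fun_prop) hdm.aestronglyMeasurable
  have hfirst : ∫ ω, X i ω * steinSol z (∑ j ∈ s, X j ω) ∂P =
      ∫ ω, (X i ω * steinSol z (U ω + X i ω) - X i ω * steinSol z (U ω)) ∂P := by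
    rw [h.integral_mul_comp_sum hfm (abs_steinSol_le z)]
    congr 1
    ext ω
    rw [hWU]
    ring
  have hR1 : |(∫ ω, X i ω * steinSol z (∑ j ∈ s, X j ω) ∂P) - v * ∫ ω, steinDeriv z (U ω) ∂P| ≤
      5 * β + 6 * (2 * β + 4 * γ * v) := by
    rw [hfirst, ← hprod, ← integral_sub hXff hXD]
    calc _ ≤ ∫ ω, (|X i ω| ^ 3 * (2 + 3 * |U ω|) +
            6 * (X i ω ^ 2 * nearKink z (U ω) (X i ω))) ∂P := by
          refine abs_integral_le_integral_abs.trans (integral_mono (hXff.sub hXD).abs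
            (hE1i.add (hE3i.const_mul 6)) fun ω => ?_)
          have := mul_le_mul_of_nonneg_left (abs_steinSol_taylor_le z (U ω) (X i ω))
            (abs_nonneg (X i ω))
          rw [← abs_mul] at this
          simp only
          rw [← sq_abs]
          calc _ = |X i ω * (steinSol z (U ω + X i ω) - steinSol z (U ω) -
                X i ω * steinDeriv z (U ω))| := by rw [sq_abs]; congr 1; ring
            _ ≤ _ := this
            _ = _ := by ring
      _ ≤ _ := by
          rw [integral_add hE1i (hE3i.const_mul 6), integral_const_mul]
          linarith
  have hR2 : |v * (∫ ω, steinDeriv z (U ω) ∂P) -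
      v * ∫ ω, steinDeriv z (∑ j ∈ s, X j ω) ∂P| ≤ 5 * β + (2 * β + 4 * γ * v) := by
    simp_rw [hWU]
    rw [← mul_sub, abs_mul, abs_of_nonneg hv0, abs_sub_comm, ← integral_sub hDW hD]
    calc _ ≤ v * ∫ ω, (|X i ω| * (2 + 3 * |U ω|) + nearKink z (U ω) (X i ω)) ∂P := by
          refine mul_le_mul_of_nonneg_left ?_ hv0
          exact abs_integral_le_integral_abs.trans (integral_mono (hDW.sub hD).abs
            (hE2i.add hE4i) fun ω => abs_steinDeriv_sub_le z (U ω) (X i ω))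
      _ ≤ _ := by
          rw [integral_add hE2i hE4i, mul_add]
          linarith
  calc _ ≤ _ := abs_sub_le _ (v * ∫ ω, steinDeriv z (U ω) ∂P) _
    _ ≤ _ := add_le_add hR1 hR2
    _ = _ := by ring

/-- The Berry–Esseen inequality for independent, not necessarily identically distributed random
variables. -/
theorem berry_esseen [Fintype ι] (h : IsCenteredIndep P X) (hv : ∑ i, ∫ ω, X i ω ^ 2 ∂P = 1)
    {γ : ℝ} (h3 : ∑ i, ∫ ω, |X i ω| ^ 3 ∂P ≤ γ) (z : ℝ) :
    |P.real {ω | ∑ i, X i ω ≤ z} - stdNormalCDF z| ≤ 52 * γ := by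
  classical
  have hv0 : ∀ i, 0 ≤ ∫ ω, X i ω ^ 2 ∂P := fun i => integral_nonneg fun _ => sq_nonneg _
  have h30 : ∀ i, 0 ≤ ∫ ω, |X i ω| ^ 3 ∂P := fun i => integral_nonneg fun _ => by positivity
  have hβγ : ∀ i, ∫ ω, |X i ω| ^ 3 ∂P ≤ γ := fun i =>
    (Finset.single_le_sum (fun i _ => h30 i) (Finset.mem_univ i)).trans h3
  -- for `γ ≥ 1 / 8` the bound exceeds `1`
  rcases le_or_gt (1 / 8) γ with hγ | hγ
  · have h1 := stdNormalCDF_nonneg z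
    have h2 := stdNormalCDF_le_one z
    have h3 : 0 ≤ P.real {ω | ∑ i, X i ω ≤ z} := measureReal_nonneg
    have h4 : P.real {ω | ∑ i, X i ω ≤ z} ≤ 1 := measureReal_le_one
    rw [abs_le]
    constructor <;> linarith
  -- no single variance is large, so that each sum without one term still concentrates
  have hvar : ∀ i, ∫ ω, X i ω ^ 2 ∂P ≤ 1 / 4 := fun i => by
    have h1 := h.pow_three_le i (Real.sqrt_nonneg _) (Real.sq_sqrt (hv0 i))
    have h2 : √(∫ ω, X i ω ^ 2 ∂P) ≤ 1 / 2 := by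
      by_contra hc
      have := pow_lt_pow_left₀ (not_le.1 hc) (by norm_num) (n := 3) (by norm_num)
      norm_num at this
      linarith [hβγ i]
    rw [← Real.sq_sqrt (hv0 i)]
    nlinarith [Real.sqrt_nonneg (∫ ω, X i ω ^ 2 ∂P)]
  have hγ0 : 0 < γ := by
    by_contra hc
    have hz : ∀ i, ∫ ω, X i ω ^ 2 ∂P = 0 := fun i => by
      have h1 := h.pow_three_le i (Real.sqrt_nonneg _) (Real.sq_sqrt (hv0 i))
      have h2 : √(∫ ω, X i ω ^ 2 ∂P) = 0 := by
        by_contra h0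
        have : 0 < √(∫ ω, X i ω ^ 2 ∂P) := lt_of_le_of_ne (Real.sqrt_nonneg _) (Ne.symm h0)
        linarith [hβγ i, pow_pos this 3]
      rw [← Real.sq_sqrt (hv0 i), h2]; norm_num
    simp [hz] at hv
  have hW := h.measurable_sum Finset.univ
  have hfm := (continuous_steinSol z).measurable
  have hdm := measurable_steinDeriv z
  set W : Ω → ℝ := fun ω => ∑ i, X i ω with hWdef
  have hDW : Integrable (fun ω => steinDeriv z (W ω)) P :=
    Integrable.of_bound (hdm.comp hW).aestronglyMeasurable 3
      (Eventually.of_forall fun _ => abs_steinDeriv_le z _)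
  have hXf : ∀ i, Integrable (fun ω => X i ω * steinSol z (W ω)) P := fun i =>
    (h.integrable i).mul_bdd (hfm.comp hW).aestronglyMeasurable
      (Eventually.of_forall fun _ => abs_steinSol_le z _)
  have hset : MeasurableSet {ω | W ω ≤ z} := hW measurableSet_Iic
  have hind : Integrable ({ω | W ω ≤ z}.indicator (fun _ => (1 : ℝ))) P :=
    (integrable_const _).indicator hset
  -- Stein's equation, integrated
  have hstein : P.real {ω | W ω ≤ z} - stdNormalCDF z =
      (∫ ω, steinDeriv z (W ω) ∂P) - ∑ i, ∫ ω, X i ω * steinSol z (W ω) ∂P := by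
    rw [← integral_finsetSum _ fun i _ => hXf i,
      ← integral_sub hDW (integrable_finsetSum _ fun i _ => hXf i)]
    have : ∀ ω, steinDeriv z (W ω) - ∑ i, X i ω * steinSol z (W ω) =
        {ω | W ω ≤ z}.indicator (fun _ => (1 : ℝ)) ω - stdNormalCDF z := fun ω => by
      rw [← Finset.sum_mul, steinDeriv, Set.indicator_apply]
      simp only [Set.mem_ofPred_eq]
      change W ω * _ + _ - _ - W ω * _ = _
      ring
    simp_rw [this]
    rw [integral_sub hind (integrable_const _), integral_indicator_const _ hset]
    simp
  have hsplit : (∫ ω, steinDeriv z (W ω) ∂P) - ∑ i, ∫ ω, X i ω * steinSol z (W ω) ∂P =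
      -∑ i, ((∫ ω, X i ω * steinSol z (W ω) ∂P) -
        (∫ ω, X i ω ^ 2 ∂P) * ∫ ω, steinDeriv z (W ω) ∂P) := by
    rw [Finset.sum_sub_distrib, ← Finset.sum_mul, hv]
    ring
  change |P.real {ω | W ω ≤ z} - stdNormalCDF z| ≤ _
  rw [hstein, hsplit, abs_neg]
  calc _ ≤ ∑ i, (24 * (∫ ω, |X i ω| ^ 3 ∂P) + 28 * γ * ∫ ω, X i ω ^ 2 ∂P) := by
        refine (Finset.abs_sum_le_sum_abs _ _).trans (Finset.sum_le_sum fun i _ => ?_)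
        have hvs : (∫ ω, X i ω ^ 2 ∂P) + ∑ j ∈ Finset.univ.erase i, ∫ ω, X j ω ^ 2 ∂P = 1 := by
          rw [← hv]
          exact Finset.add_sum_erase _ (fun j => ∫ ω, X j ω ^ 2 ∂P) (Finset.mem_univ i)
        have h3s : ∑ j ∈ Finset.univ.erase i, ∫ ω, |X j ω| ^ 3 ∂P ≤ γ :=
          (Finset.sum_le_sum_of_subset_of_nonneg (Finset.erase_subset _ _)
            fun j _ _ => h30 j).trans h3
        refine h.abs_integral_mul_steinSol_sub_le (Finset.mem_univ i) z
          (h.integral_abs_sum_le_one (by linarith [hv0 i])) fun t ht => ?_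
        have := h.concentration hγ0 (s := Finset.univ.erase i) (by linarith [hvar i])
          (by linarith [hv0 i]) h3s (a := z - t) (b := z + t) (by linarith)
        linarith
    _ ≤ 52 * γ := by
        rw [Finset.sum_add_distrib, ← Finset.mul_sum, ← Finset.mul_sum, hv]
        linarith

end IsCenteredIndep

/-! ### Exponential moments under Bernstein's condition -/

/-- A centered law on `ℝ` with moments of all orders satisfying Bernstein's condition with
constant `r > 0`. -/
structure IsBernsteinLaw (μ : Measure ℝ) (r : ℝ) : Prop where
  pos : 0 < r
  integrable_pow : ∀ k : ℕ, Integrable (fun x => x ^ k) μ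
  centered : ∫ x, x ∂μ = 0
  bernstein : ∀ k : ℕ, 3 ≤ k →
    |∫ x, x ^ k ∂μ| ≤ 1 / 2 * (Nat.factorial k : ℝ) * r ^ (k - 2) * ∫ x, x ^ 2 ∂μ

lemma exp_abs_le_two_mul_cosh (y : ℝ) : Real.exp |y| ≤ 2 * Real.cosh y := by
  rw [← Real.cosh_abs, Real.cosh_eq]
  linarith [Real.exp_pos (-|y|)]

/-- Termwise comparison of the power series of both sides. -/
lemma pow_four_mul_cosh_half_le (y : ℝ) :
    y ^ 4 * Real.cosh (y / 2) ≤ 105 * (Real.cosh y - 1 - y ^ 2 / 2) := by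
  have h1 := (Real.hasSum_cosh (y / 2)).mul_left (y ^ 4)
  have h2 := ((hasSum_nat_add_iff' 2).2 (Real.hasSum_cosh y)).mul_left 105
  have h3 : ∀ k : ℕ, (2 * k + 4) * (2 * k + 3) * (2 * k + 2) * (2 * k + 1) ≤ 105 * 4 ^ k := by
    intro k
    rcases Nat.lt_or_ge k 3 with hk | hk
    · interval_cases k <;> norm_num
    · induction k, hk using Nat.le_induction with
      | base => norm_num
      | succ k hk ih =>
        rw [pow_succ, ← mul_assoc]
        refine le_trans ?_ (Nat.mul_le_mul_right 4 ih)
        obtain ⟨j, rfl⟩ := Nat.exists_eq_add_of_le hk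
        ring_nf
        nlinarith
  have e2 : Real.cosh y - ∑ i ∈ Finset.range 2, y ^ (2 * i) / ((2 * i).factorial : ℝ) =
      Real.cosh y - 1 - y ^ 2 / 2 := by
    simp [Finset.sum_range_succ, Nat.factorial]; ring
  rw [e2] at h2
  refine hasSum_le (fun k => ?_) h1 h2
  have hf : ((2 * (k + 2)).factorial : ℝ) =
      (2 * k + 4) * (2 * k + 3) * (2 * k + 2) * (2 * k + 1) * (2 * k).factorial := by
    rw [show 2 * (k + 2) = 2 * k + 3 + 1 by ring, Nat.factorial_succ, Nat.factorial_succ,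
      Nat.factorial_succ, Nat.factorial_succ]
    push_cast
    ring
  have h4 : ((2 * k + 4) * (2 * k + 3) * (2 * k + 2) * (2 * k + 1) : ℝ) ≤ 105 * 4 ^ k := by
    exact_mod_cast h3 k
  have hfp : (0 : ℝ) < (2 * k).factorial := by positivity
  have hy : 0 ≤ y ^ (2 * (k + 2)) := by rw [pow_mul]; positivity
  have e : y ^ 4 * ((y / 2) ^ (2 * k) / (2 * k).factorial) =
      y ^ (2 * (k + 2)) / (4 ^ k * (2 * k).factorial) := by
    rw [div_pow, pow_mul 2 2 k]
    norm_num
    field_simp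
    ring
  rw [e, hf, ← mul_div_assoc, div_le_div_iff₀ (by positivity) (by positivity)]
  calc _ = (y ^ (2 * (k + 2)) * (2 * k).factorial) *
        ((2 * k + 4) * (2 * k + 3) * (2 * k + 2) * (2 * k + 1)) := by ring
    _ ≤ (y ^ (2 * (k + 2)) * (2 * k).factorial) * (105 * 4 ^ k) := by gcongr
    _ = _ := by ring

namespace IsBernsteinLaw

variable {μ : Measure ℝ} {r : ℝ}

lemma integrable_sq (h : IsBernsteinLaw μ r) : Integrable (fun x => x ^ 2) μ := h.integrable_pow 2

lemma integrable_id (h : IsBernsteinLaw μ r) : Integrable (fun x => x) μ := by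
  simpa using h.integrable_pow 1

lemma integral_sq_nonneg : 0 ≤ ∫ x, x ^ 2 ∂μ := integral_nonneg fun _ => sq_nonneg _

lemma half_mul_lt_one (h : IsBernsteinLaw μ r) : |1 / (2 * r)| * r < 1 := by
  have := h.pos
  rw [abs_of_pos (by positivity)]
  field_simp
  norm_num

lemma integral_cosh_term_le (h : IsBernsteinLaw μ r) {t : ℝ} (k : ℕ) :
    ∫ x, (t * x) ^ (2 * (k + 2)) / ((2 * (k + 2)).factorial : ℝ) ∂μ ≤
      1 / 2 * (∫ x, x ^ 2 ∂μ) * t ^ 4 * r ^ 2 * ((t * r) ^ 2) ^ k := by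
  have h1 := (le_abs_self _).trans (h.bernstein (2 * (k + 2)) (by omega))
  rw [integral_div]
  simp_rw [mul_pow]
  rw [integral_const_mul, div_le_iff₀ (by positivity)]
  have ht : 0 ≤ t ^ (2 * (k + 2)) := by rw [pow_mul]; positivity
  calc _ ≤ _ := mul_le_mul_of_nonneg_left h1 ht
    _ = _ := by
      rw [show 2 * (k + 2) - 2 = 2 * k + 2 by omega]
      ring

lemma summable_integral_cosh_term (h : IsBernsteinLaw μ r) {t : ℝ} (ht : |t| * r < 1) :
    Summable (fun k : ℕ => ∫ x, (t * x) ^ (2 * k) / ((2 * k).factorial : ℝ) ∂μ) := by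
  rw [← summable_nat_add_iff 2]
  have hq : (t * r) ^ 2 < 1 := by
    have h0 : 0 ≤ |t| * r := mul_nonneg (abs_nonneg _) h.pos.le
    rw [← sq_abs, abs_mul, abs_of_pos h.pos]
    nlinarith
  refine Summable.of_nonneg_of_le (fun k => integral_nonneg fun x => ?_)
    (fun k => h.integral_cosh_term_le k)
    ((summable_geometric_of_lt_one (sq_nonneg _) hq).mul_left _)
  rw [pow_mul]
  simp only [Pi.zero_apply]
  positivity

/-- By Tonelli's theorem, as all terms of the power series of `cosh` are nonnegative. -/
lemma integrable_cosh (h : IsBernsteinLaw μ r) {t : ℝ} (ht : |t| * r < 1) :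
    Integrable (fun x => Real.cosh (t * x)) μ := by
  have hF0 : ∀ (k : ℕ) (x : ℝ), 0 ≤ (t * x) ^ (2 * k) / ((2 * k).factorial : ℝ) := fun k x => by
    rw [pow_mul]; positivity
  have hFi : ∀ k : ℕ, Integrable (fun x => (t * x) ^ (2 * k) / ((2 * k).factorial : ℝ)) μ := by
    intro k
    simp_rw [mul_pow]
    exact ((h.integrable_pow _).const_mul _).div_const _
  refine ⟨by fun_prop, ?_⟩
  rw [hasFiniteIntegral_iff_ofReal (Eventually.of_forall fun x => (Real.cosh_pos _).le)]
  have e : ∀ x, ENNReal.ofReal (Real.cosh (t * x)) =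
      ∑' k : ℕ, ENNReal.ofReal ((t * x) ^ (2 * k) / ((2 * k).factorial : ℝ)) := fun x => by
    rw [← ENNReal.ofReal_tsum_of_nonneg (fun k => hF0 k x) (Real.hasSum_cosh _).summable,
      (Real.hasSum_cosh _).tsum_eq]
  simp_rw [e]
  rw [lintegral_tsum fun k => (by fun_prop)]
  simp_rw [← ofReal_integral_eq_lintegral_ofReal (hFi _) (Eventually.of_forall (hF0 _))]
  rw [← ENNReal.ofReal_tsum_of_nonneg (fun k => integral_nonneg (hF0 k))
    (h.summable_integral_cosh_term ht)]
  exact ENNReal.ofReal_lt_top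

lemma integrable_exp_abs (h : IsBernsteinLaw μ r) {t : ℝ} (ht : |t| * r < 1) :
    Integrable (fun x => Real.exp |t * x|) μ := by
  refine ((h.integrable_cosh ht).const_mul 2).mono' (by fun_prop)
    (Eventually.of_forall fun x => ?_)
  rw [Real.norm_eq_abs, Real.abs_exp]
  exact exp_abs_le_two_mul_cosh _

lemma integrable_exp (h : IsBernsteinLaw μ r) {t : ℝ} (ht : |t| * r < 1) :
    Integrable (fun x => Real.exp (t * x)) μ := by
  refine (h.integrable_exp_abs ht).mono' (by fun_prop) (Eventually.of_forall fun x => ?_)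
  rw [Real.norm_eq_abs, Real.abs_exp]
  exact Real.exp_le_exp.2 (le_abs_self _)

variable [IsProbabilityMeasure μ]

/-- The condition with `k = 4` bounds the variance, since `(E ξ²)² ≤ E ξ⁴`. -/
lemma integral_sq_le (h : IsBernsteinLaw μ r) : ∫ x, x ^ 2 ∂μ ≤ 12 * r ^ 2 := by
  set s := ∫ x, x ^ 2 ∂μ with hs
  have hs0 : 0 ≤ s := integral_sq_nonneg
  have h4 := (le_abs_self _).trans (h.bernstein 4 (by norm_num))
  norm_num [Nat.factorial] at h4
  have h1 : 0 ≤ ∫ x, (x ^ 4 - (2 * s * x ^ 2 - s ^ 2)) ∂μ :=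
    integral_nonneg fun x => by
      have := sq_nonneg (x ^ 2 - s)
      simp only [Pi.zero_apply]
      nlinarith
  have hi : Integrable (fun x => 2 * s * x ^ 2 - s ^ 2) μ :=
    (h.integrable_sq.const_mul _).sub (integrable_const _)
  rw [integral_sub (h.integrable_pow 4) hi, integral_sub (h.integrable_sq.const_mul _)
    (integrable_const _), integral_const_mul, ← hs] at h1
  simp at h1
  rcases hs0.eq_or_lt with h0 | h0
  · rw [← h0]; positivity
  · have : s * s ≤ (12 * r ^ 2) * s := by nlinarith
    exact le_of_mul_le_mul_right this h0

lemma integral_cosh_sub_le (h : IsBernsteinLaw μ r) {t : ℝ} (ht : |t| * r < 1) :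
    ∫ x, (Real.cosh (t * x) - 1 - (t * x) ^ 2 / 2) ∂μ ≤
      1 / 2 * (∫ x, x ^ 2 ∂μ) * t ^ 4 * r ^ 2 * (1 - (t * r) ^ 2)⁻¹ := by
  have hq : (t * r) ^ 2 < 1 := by
    have h0 : 0 ≤ |t| * r := mul_nonneg (abs_nonneg _) h.pos.le
    rw [← sq_abs, abs_mul, abs_of_pos h.pos]
    nlinarith
  have hsum : ∀ x, HasSum (fun k : ℕ => (t * x) ^ (2 * (k + 2)) / ((2 * (k + 2)).factorial : ℝ))
      (Real.cosh (t * x) - 1 - (t * x) ^ 2 / 2) := fun x => by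
    have h2 := (hasSum_nat_add_iff' 2).2 (Real.hasSum_cosh (t * x))
    have e : Real.cosh (t * x) - ∑ i ∈ Finset.range 2, (t * x) ^ (2 * i) / ((2 * i).factorial : ℝ) =
        Real.cosh (t * x) - 1 - (t * x) ^ 2 / 2 := by
      simp [Finset.sum_range_succ, Nat.factorial]; ring
    rwa [e] at h2
  have h0 : ∀ (k : ℕ) (x : ℝ), 0 ≤ (t * x) ^ (2 * (k + 2)) / ((2 * (k + 2)).factorial : ℝ) :=
    fun k x => by rw [pow_mul]; positivity
  have h1 : HasSum (fun k : ℕ => ∫ x, (t * x) ^ (2 * (k + 2)) / ((2 * (k + 2)).factorial : ℝ) ∂μ)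
      (∫ x, (Real.cosh (t * x) - 1 - (t * x) ^ 2 / 2) ∂μ) := by
    refine hasSum_integral_of_dominated_convergence
      (fun k x => (t * x) ^ (2 * (k + 2)) / ((2 * (k + 2)).factorial : ℝ))
      (fun k => by fun_prop) (fun k => Eventually.of_forall fun x => ?_)
      (Eventually.of_forall fun x => (hsum x).summable) ?_
      (Eventually.of_forall hsum)
    · rw [Real.norm_eq_abs, abs_of_nonneg (h0 k x)]
    · simp_rw [(hsum _).tsum_eq, mul_pow]
      exact ((h.integrable_cosh ht).sub (integrable_const _)).sub
        ((h.integrable_sq.const_mul _).div_const _)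
  exact hasSum_le (fun k => h.integral_cosh_term_le k) h1
    ((hasSum_geometric_of_lt_one (sq_nonneg _) hq).mul_left _)

/-- Bernstein's bound for the Laplace transform. -/
lemma integral_exp_le (h : IsBernsteinLaw μ r) {t : ℝ} (ht0 : 0 ≤ t) (ht : t * r < 1) :
    ∫ x, Real.exp (t * x) ∂μ ≤ 1 + t ^ 2 * (∫ x, x ^ 2 ∂μ) / (2 * (1 - t * r)) := by
  have ht' : |t| * r < 1 := by rwa [abs_of_nonneg ht0]
  have hsum : ∀ x, HasSum (fun k : ℕ => (t * x) ^ k / (k.factorial : ℝ)) (Real.exp (t * x)) :=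
    fun x => by
      rw [Real.exp_eq_exp_ℝ]
      exact NormedSpace.expSeries_div_hasSum_exp (t * x)
  have hsuma : ∀ x, HasSum (fun k : ℕ => |t * x| ^ k / (k.factorial : ℝ)) (Real.exp |t * x|) :=
    fun x => by
      rw [Real.exp_eq_exp_ℝ]
      exact NormedSpace.expSeries_div_hasSum_exp |t * x|
  have h1 : HasSum (fun k : ℕ => ∫ x, (t * x) ^ k / (k.factorial : ℝ) ∂μ)
      (∫ x, Real.exp (t * x) ∂μ) := by
    refine hasSum_integral_of_dominated_convergence
      (fun k x => |t * x| ^ k / (k.factorial : ℝ))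
      (fun k => by fun_prop) (fun k => Eventually.of_forall fun x => ?_)
      (Eventually.of_forall fun x => (hsuma x).summable) ?_
      (Eventually.of_forall hsum)
    · simp
    · simp_rw [(hsuma _).tsum_eq]
      exact h.integrable_exp_abs ht'
  have h2 := (hasSum_nat_add_iff' 2).2 h1
  have h4 : ∀ k : ℕ, ∫ x, (t * x) ^ (k + 2) / ((k + 2).factorial : ℝ) ∂μ ≤
      t ^ 2 * (∫ x, x ^ 2 ∂μ) / 2 * (t * r) ^ k := fun k => ?_
  · have h3 := hasSum_le h4 h2
      ((hasSum_geometric_of_lt_one (mul_nonneg ht0 h.pos.le) ht).mul_left _)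
    have hz : ∫ x, t * x ∂μ = 0 := by rw [integral_const_mul, h.centered, mul_zero]
    simp [Finset.sum_range_succ, hz] at h3
    have e : t ^ 2 * (∫ x, x ^ 2 ∂μ) / (2 * (1 - t * r)) =
        t ^ 2 * (∫ x, x ^ 2 ∂μ) / 2 * (1 - t * r)⁻¹ := by
      rw [div_mul_eq_div_div, div_eq_mul_inv]
    rw [e]
    linarith
  · rw [integral_div, div_le_iff₀ (by positivity)]
    simp_rw [mul_pow]
    rw [integral_const_mul]
    rcases Nat.eq_zero_or_pos k with rfl | hk
    · norm_num
    · have := mul_le_mul_of_nonneg_left ((le_abs_self _).trans (h.bernstein (k + 2) (by omega)))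
        (pow_nonneg ht0 (k + 2))
      refine this.trans (le_of_eq ?_)
      rw [Nat.add_sub_cancel]
      ring

lemma one_le_integral_exp (h : IsBernsteinLaw μ r) {t : ℝ} (ht : |t| * r < 1) :
    1 ≤ ∫ x, Real.exp (t * x) ∂μ := by
  calc (1 : ℝ) = ∫ x, (t * x + 1) ∂μ := by
        rw [integral_add (h.integrable_id.const_mul _) (integrable_const _), integral_const_mul,
          h.centered]
        simp
    _ ≤ _ := integral_mono ((h.integrable_id.const_mul _).add (integrable_const _))
        (h.integrable_exp ht) fun x => Real.add_one_le_exp _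

lemma pow_three_mul_exp_le {r : ℝ} (hr : 0 < r) (x : ℝ) :
    |x| ^ 3 * Real.exp (|x| / (4 * r)) ≤
      2 * r * x ^ 2 + 2 / r * (x ^ 4 * Real.cosh (x / (4 * r))) := by
  have hx := abs_nonneg x
  have hc : 0 ≤ 2 / r * (x ^ 4 * Real.cosh (x / (4 * r))) := by
    have := Real.cosh_pos (x / (4 * r))
    positivity
  rcases le_total |x| r with h | h
  · have h1 : Real.exp (|x| / (4 * r)) ≤ 2 := by
      refine le_trans (Real.exp_le_exp.2 ?_) exp_half_le_two
      rw [div_le_iff₀ (by positivity)]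
      linarith
    have h2 : |x| ^ 3 ≤ r * x ^ 2 := by
      rw [← sq_abs]; nlinarith [sq_nonneg |x|]
    calc _ ≤ (r * x ^ 2) * 2 := by gcongr
      _ ≤ _ := by linarith
  · have h1 : |x| ^ 3 ≤ x ^ 4 / r := by
      rw [le_div_iff₀ hr, ← Even.pow_abs ⟨2, rfl⟩ x]
      have := mul_le_mul_of_nonneg_left h (pow_nonneg hx 3)
      calc _ ≤ |x| ^ 3 * |x| := this
        _ = _ := by ring
    have h2 : Real.exp (|x| / (4 * r)) ≤ 2 * Real.cosh (x / (4 * r)) := by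
      have := exp_abs_le_two_mul_cosh (x / (4 * r))
      rwa [abs_div, abs_of_pos (show 0 < 4 * r by positivity)] at this
    calc _ ≤ (x ^ 4 / r) * (2 * Real.cosh (x / (4 * r))) := by gcongr
      _ = 2 / r * (x ^ 4 * Real.cosh (x / (4 * r))) := by ring
      _ ≤ _ := by nlinarith [sq_nonneg x]

lemma pow_four_mul_cosh_le {r : ℝ} (hr : 0 < r) (x : ℝ) :
    x ^ 4 * Real.cosh (x / (4 * r)) ≤ 1680 * r ^ 4 *
      (Real.cosh (1 / (2 * r) * x) - 1 - (1 / (2 * r) * x) ^ 2 / 2) := by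
  have := mul_le_mul_of_nonneg_left (pow_four_mul_cosh_half_le (1 / (2 * r) * x))
    (show 0 ≤ 16 * r ^ 4 by positivity)
  have e : 1 / (2 * r) * x / 2 = x / (4 * r) := by field_simp; ring
  rw [e] at this
  calc _ = 16 * r ^ 4 * ((1 / (2 * r) * x) ^ 4 * Real.cosh (x / (4 * r))) := by field_simp; ring
    _ ≤ _ := this
    _ = _ := by ring

lemma integrable_pow_three_mul_exp (h : IsBernsteinLaw μ r) :
    Integrable (fun x => |x| ^ 3 * Real.exp (|x| / (4 * r))) μ := by
  have hi := ((((h.integrable_cosh h.half_mul_lt_one).sub (integrable_const 1)).sub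
    ((((h.integrable_sq.const_mul ((1 / (2 * r)) ^ 2))).div_const 2))).const_mul
      (1680 * r ^ 4)).const_mul (2 / r)
  refine ((h.integrable_sq.const_mul (2 * r)).add hi).mono' (by fun_prop)
    (Eventually.of_forall fun x => ?_)
  have hr := h.pos
  rw [Real.norm_eq_abs, abs_of_nonneg (by positivity)]
  refine (pow_three_mul_exp_le hr x).trans ?_
  have := mul_le_mul_of_nonneg_left (pow_four_mul_cosh_le hr x) (show 0 ≤ 2 / r by positivity)
  simpa [mul_pow] using this

/-- Even moments control the absolute third moment, with an exponential weight to spare: odd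
absolute moments are not part of Bernstein's condition. -/
lemma integral_pow_three_mul_exp_le (h : IsBernsteinLaw μ r) :
    ∫ x, |x| ^ 3 * Real.exp (|x| / (4 * r)) ∂μ ≤ 142 * r * ∫ x, x ^ 2 ∂μ := by
  have hr := h.pos
  set s := ∫ x, x ^ 2 ∂μ with hs
  have hi : Integrable
      (fun x => Real.cosh (1 / (2 * r) * x) - 1 - (1 / (2 * r) * x) ^ 2 / 2) μ := by
    simp_rw [mul_pow]
    exact ((h.integrable_cosh h.half_mul_lt_one).sub (integrable_const 1)).sub
      ((h.integrable_sq.const_mul _).div_const 2)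
  calc _ ≤ ∫ x, (2 * r * x ^ 2 + 2 / r * (1680 * r ^ 4 *
        (Real.cosh (1 / (2 * r) * x) - 1 - (1 / (2 * r) * x) ^ 2 / 2))) ∂μ := by
        refine integral_mono h.integrable_pow_three_mul_exp
          ((h.integrable_sq.const_mul _).add ((hi.const_mul _).const_mul _)) fun x => ?_
        refine (pow_three_mul_exp_le hr x).trans ?_
        have := mul_le_mul_of_nonneg_left (pow_four_mul_cosh_le hr x)
          (show 0 ≤ 2 / r by positivity)
        linarith
    _ ≤ 2 * r * s + 2 / r * (1680 * r ^ 4 * (1 / 2 * s * (1 / (2 * r)) ^ 4 * r ^ 2 *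
          (1 - (1 / (2 * r) * r) ^ 2)⁻¹)) := by
        rw [integral_add (h.integrable_sq.const_mul _) ((hi.const_mul _).const_mul _),
          integral_const_mul, integral_const_mul, integral_const_mul]
        gcongr
        exact h.integral_cosh_sub_le h.half_mul_lt_one
    _ = 142 * r * s := by
        have e : 1 / (2 * r) * r = 1 / 2 := by field_simp
        rw [e]
        norm_num
        field_simp
        ring

end IsBernsteinLaw

/-! ### Moments of the conjugate laws -/

lemma abs_exp_sub_one_le_mul_exp (u : ℝ) : |Real.exp u - 1| ≤ |u| * Real.exp |u| := by
  have h := Complex.norm_exp_sub_sum_le_norm_mul_exp (u : ℂ) 1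
  simp only [Finset.sum_range_one, pow_zero, Nat.factorial_zero, Nat.cast_one, div_one, pow_one,
    Complex.norm_real, Real.norm_eq_abs] at h
  rw [← Complex.ofReal_exp, ← Complex.ofReal_one, ← Complex.ofReal_sub, Complex.norm_real] at h
  exact h

lemma abs_exp_sub_one_sub_le_mul_exp (u : ℝ) :
    |Real.exp u - 1 - u| ≤ |u| ^ 2 * Real.exp |u| := by
  have h := Complex.norm_exp_sub_sum_le_norm_mul_exp (u : ℂ) 2
  simp only [Finset.sum_range_succ, Finset.sum_range_zero, pow_zero, Nat.factorial_zero,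
    Nat.cast_one, div_one, pow_one, Nat.factorial_one, zero_add,
    Complex.norm_real, Real.norm_eq_abs] at h
  rw [← Complex.ofReal_exp, ← Complex.ofReal_one, ← Complex.ofReal_add, ← Complex.ofReal_sub,
    Complex.norm_real] at h
  rw [sub_sub]
  exact h

/-- The conjugate (Esscher transformed) law with parameter `t`. -/
noncomputable def conjLaw (μ : Measure ℝ) (t : ℝ) : Measure ℝ := μ.tilted (fun x => t * x)

/-- The mean of the conjugate law. -/
noncomputable def conjMean (μ : Measure ℝ) (t : ℝ) : ℝ := ∫ x, x ∂(conjLaw μ t)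

lemma integral_conjLaw (μ : Measure ℝ) (t : ℝ) (g : ℝ → ℝ) :
    ∫ x, g x ∂(conjLaw μ t) = (∫ x, Real.exp (t * x) * g x ∂μ) / ∫ x, Real.exp (t * x) ∂μ := by
  rw [conjLaw, integral_tilted, ← integral_div]
  congr 1
  ext x
  rw [smul_eq_mul]
  ring

lemma abs_mul_lt_one_of_le {t r : ℝ} (ht0 : 0 ≤ t) (ht : t * r ≤ 1 / 1000) : |t| * r < 1 := by
  rw [abs_of_nonneg ht0]; linarith

namespace IsBernsteinLaw

variable {μ : Measure ℝ} {r : ℝ}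

lemma exp_abs_mul_le (h : IsBernsteinLaw μ r) {t : ℝ} (ht0 : 0 ≤ t) (ht : t * r ≤ 1 / 1000)
    (x : ℝ) : Real.exp |t * x| ≤ Real.exp (|x| / (4 * r)) := by
  have := h.pos
  rw [Real.exp_le_exp, abs_mul, abs_of_nonneg ht0, le_div_iff₀ (by positivity)]
  nlinarith [abs_nonneg x]

lemma exp_mul_le (h : IsBernsteinLaw μ r) {t : ℝ} (ht0 : 0 ≤ t) (ht : t * r ≤ 1 / 1000)
    (x : ℝ) : Real.exp (t * x) ≤ Real.exp (|x| / (4 * r)) :=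
  (Real.exp_le_exp.2 (le_abs_self _)).trans (h.exp_abs_mul_le ht0 ht x)

/-- The conjugate mean is the derivative of the cumulant generating function. -/
lemma continuousOn_conjMean (h : IsBernsteinLaw μ r) :
    ContinuousOn (conjMean μ) (Set.Icc 0 (1 / (1000 * r))) := by
  have hr := h.pos
  have hsub : Set.Ioo (-(1 / r)) (1 / r) ⊆ integrableExpSet id μ := by
    intro t ht
    have : |t| * r < 1 := by
      rw [← lt_div_iff₀ hr]; exact abs_lt.2 ht
    exact h.integrable_exp this
  have hint : Set.Icc 0 (1 / (1000 * r)) ⊆ interior (integrableExpSet id μ) := by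
    refine Set.Subset.trans ?_ (interior_maximal hsub isOpen_Ioo)
    intro t ht
    have h1 : 0 < 1 / r := by positivity
    have h2 : 1 / (1000 * r) < 1 / r := by
      apply one_div_lt_one_div_of_lt hr; linarith
    exact ⟨by linarith [ht.1], by linarith [ht.2]⟩
  have hc : ContinuousOn (deriv (cgf id μ)) (interior (integrableExpSet id μ)) :=
    analyticOnNhd_cgf.deriv.continuousOn
  refine (hc.mono hint).congr fun t ht => ?_
  exact integral_tilted_mul_self (hint ht)

variable [IsProbabilityMeasure μ]

lemma isProbabilityMeasure_conj (h : IsBernsteinLaw μ r) {t : ℝ} (ht : |t| * r < 1) :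
    IsProbabilityMeasure (conjLaw μ t) := isProbabilityMeasure_tilted (h.integrable_exp ht)

lemma integrable_exp_mul_of_le (h : IsBernsteinLaw μ r) {t : ℝ} (ht0 : 0 ≤ t)
    (ht : t * r ≤ 1 / 1000) {g : ℝ → ℝ} (hg : Measurable g) {c : ℝ}
    (hgc : ∀ x, |g x| ≤ c * (1 + |x| ^ 3)) :
    Integrable (fun x => Real.exp (t * x) * g x) μ := by
  refine (((h.integrable_exp (abs_mul_lt_one_of_le ht0 ht)).add
    h.integrable_pow_three_mul_exp).const_mul c).mono' (by fun_prop)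
    (Eventually.of_forall fun x => ?_)
  rw [Real.norm_eq_abs, abs_mul, Real.abs_exp]
  have h1 := hgc x
  have h2 := h.exp_mul_le ht0 ht x
  have hc : 0 ≤ c := by
    have := (abs_nonneg _).trans (hgc 0)
    simpa using this
  have h3 := Real.exp_pos (t * x)
  calc _ ≤ Real.exp (t * x) * (c * (1 + |x| ^ 3)) := by gcongr
    _ = c * (Real.exp (t * x) + |x| ^ 3 * Real.exp (t * x)) := by ring
    _ ≤ _ := by simp only [Pi.add_apply]; gcongr

lemma integrable_conj_of_le (h : IsBernsteinLaw μ r) {t : ℝ} (ht0 : 0 ≤ t)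
    (ht : t * r ≤ 1 / 1000) {g : ℝ → ℝ} (hg : Measurable g) {c : ℝ}
    (hgc : ∀ x, |g x| ≤ c * (1 + |x| ^ 3)) : Integrable g (conjLaw μ t) := by
  rw [conjLaw, integrable_tilted_iff (h.integrable_exp (abs_mul_lt_one_of_le ht0 ht))]
  exact h.integrable_exp_mul_of_le ht0 ht hg hgc

lemma abs_le_one_add (x : ℝ) : |x| ≤ 1 * (1 + |x| ^ 3) := by
  have := abs_nonneg x
  rcases le_total |x| 1 with h | h
  · nlinarith [pow_nonneg this 3]
  · nlinarith [pow_nonneg this 2, mul_nonneg this (mul_nonneg (sub_nonneg.2 h) (sub_nonneg.2 h))]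

lemma abs_sq_le_one_add (x : ℝ) : |x ^ 2| ≤ 1 * (1 + |x| ^ 3) := by
  rw [abs_pow]
  have := abs_nonneg x
  rcases le_total |x| 1 with h | h
  · nlinarith [pow_nonneg this 3]
  · nlinarith [pow_nonneg this 2]

lemma abs_cube_le_one_add (x : ℝ) : |(|x| ^ 3)| ≤ 1 * (1 + |x| ^ 3) := by
  rw [abs_of_nonneg (by positivity)]; linarith

lemma integral_exp_sub_one_le (h : IsBernsteinLaw μ r) {t : ℝ} (ht0 : 0 ≤ t)
    (ht : t * r ≤ 1 / 1000) :
    (∫ x, Real.exp (t * x) ∂μ) - 1 ≤ 8 * (t * r) ^ 2 := by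
  have h1 := h.integral_exp_le ht0 (by linarith)
  have h2 : t ^ 2 * (∫ x, x ^ 2 ∂μ) / (2 * (1 - t * r)) ≤ 8 * (t * r) ^ 2 := by
    rw [div_le_iff₀ (by linarith)]
    have := mul_le_mul_of_nonneg_left h.integral_sq_le (sq_nonneg t)
    nlinarith [sq_nonneg (t * r)]
  linarith

lemma abs_integral_mul_exp_sub_le (h : IsBernsteinLaw μ r) {t : ℝ} (ht0 : 0 ≤ t)
    (ht : t * r ≤ 1 / 1000) :
    |(∫ x, Real.exp (t * x) * x ∂μ) - t * ∫ x, x ^ 2 ∂μ| ≤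
      142 * (t * r) * (t * ∫ x, x ^ 2 ∂μ) := by
  have hi : Integrable (fun x => Real.exp (t * x) * x) μ :=
    h.integrable_exp_mul_of_le ht0 ht measurable_id abs_le_one_add
  have hi2 : Integrable (fun x => x + t * x ^ 2) μ :=
    h.integrable_id.add (h.integrable_sq.const_mul t)
  have e : t * ∫ x, x ^ 2 ∂μ = ∫ x, (x + t * x ^ 2) ∂μ := by
    rw [integral_add h.integrable_id (h.integrable_sq.const_mul t), h.centered, integral_const_mul,
      zero_add]
  calc _ = |∫ x, (Real.exp (t * x) * x - (x + t * x ^ 2)) ∂μ| := by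
        rw [e, integral_sub hi hi2]
    _ ≤ ∫ x, t ^ 2 * (|x| ^ 3 * Real.exp (|x| / (4 * r))) ∂μ := by
        refine abs_integral_le_integral_abs.trans (integral_mono (hi.sub hi2).abs
          (h.integrable_pow_three_mul_exp.const_mul _) fun x => ?_)
        calc |Real.exp (t * x) * x - (x + t * x ^ 2)|
            = |x| * |Real.exp (t * x) - 1 - t * x| := by rw [← abs_mul]; congr 1; ring
          _ ≤ |x| * (|t * x| ^ 2 * Real.exp (|x| / (4 * r))) := by
              gcongr
              exact (abs_exp_sub_one_sub_le_mul_exp _).trans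
                (mul_le_mul_of_nonneg_left (h.exp_abs_mul_le ht0 ht x) (by positivity))
          _ = _ := by rw [abs_mul, abs_of_nonneg ht0]; ring
    _ ≤ _ := by
        rw [integral_const_mul]
        calc _ ≤ t ^ 2 * (142 * r * ∫ x, x ^ 2 ∂μ) := by
              gcongr; exact h.integral_pow_three_mul_exp_le
          _ = _ := by ring

lemma abs_integral_sq_mul_exp_sub_le (h : IsBernsteinLaw μ r) {t : ℝ} (ht0 : 0 ≤ t)
    (ht : t * r ≤ 1 / 1000) :
    |(∫ x, Real.exp (t * x) * x ^ 2 ∂μ) - ∫ x, x ^ 2 ∂μ| ≤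
      142 * (t * r) * ∫ x, x ^ 2 ∂μ := by
  have hi : Integrable (fun x => Real.exp (t * x) * x ^ 2) μ :=
    h.integrable_exp_mul_of_le ht0 ht (measurable_id.pow_const 2) abs_sq_le_one_add
  calc _ = |∫ x, (Real.exp (t * x) * x ^ 2 - x ^ 2) ∂μ| := by
        rw [integral_sub hi h.integrable_sq]
    _ ≤ ∫ x, t * (|x| ^ 3 * Real.exp (|x| / (4 * r))) ∂μ := by
        refine abs_integral_le_integral_abs.trans (integral_mono (hi.sub h.integrable_sq).abs
          (h.integrable_pow_three_mul_exp.const_mul _) fun x => ?_)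
        calc |Real.exp (t * x) * x ^ 2 - x ^ 2|
            = |x| ^ 2 * |Real.exp (t * x) - 1| := by
              rw [← abs_pow, ← abs_mul]; congr 1; ring
          _ ≤ |x| ^ 2 * (|t * x| * Real.exp (|x| / (4 * r))) := by
              gcongr
              exact (abs_exp_sub_one_le_mul_exp _).trans
                (mul_le_mul_of_nonneg_left (h.exp_abs_mul_le ht0 ht x) (by positivity))
          _ = _ := by rw [abs_mul, abs_of_nonneg ht0]; ring
    _ ≤ _ := by
        rw [integral_const_mul]
        calc _ ≤ t * (142 * r * ∫ x, x ^ 2 ∂μ) := by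
              gcongr; exact h.integral_pow_three_mul_exp_le
          _ = _ := by ring

/-- Dividing by a normalization close to `1` changes a quantity close to `a` only a little. -/
lemma abs_div_sub_le {N D a κ η : ℝ} (ha : 0 ≤ a) (hD : 1 ≤ D) (hD' : D - 1 ≤ η)
    (hN : |N - a| ≤ κ * a) : |N / D - a| ≤ (κ + η) * a := by
  have hD0 : 0 < D := by linarith
  have e : N / D - a = (N - a) / D - a * ((D - 1) / D) := by field_simp; ring
  have h1 : |(N - a) / D| ≤ κ * a := by
    rw [abs_div, abs_of_pos hD0, div_le_iff₀ hD0]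
    nlinarith [abs_nonneg (N - a)]
  have h2 : |a * ((D - 1) / D)| ≤ a * η := by
    rw [abs_mul, abs_of_nonneg ha]
    refine mul_le_mul_of_nonneg_left ?_ ha
    rw [abs_of_nonneg (div_nonneg (by linarith) hD0.le), div_le_iff₀ hD0]
    nlinarith
  rw [e]
  calc _ ≤ _ := abs_sub _ _
    _ ≤ κ * a + a * η := add_le_add h1 h2
    _ = _ := by ring

lemma abs_conjMean_sub_le (h : IsBernsteinLaw μ r) {t : ℝ} (ht0 : 0 ≤ t)
    (ht : t * r ≤ 1 / 1000) :
    |conjMean μ t - t * ∫ x, x ^ 2 ∂μ| ≤ 150 * (t * r) * (t * ∫ x, x ^ 2 ∂μ) := by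
  have h0 : 0 ≤ t * ∫ x, x ^ 2 ∂μ := mul_nonneg ht0 integral_sq_nonneg
  rw [conjMean, integral_conjLaw]
  refine (abs_div_sub_le h0 (h.one_le_integral_exp (abs_mul_lt_one_of_le ht0 ht))
    (h.integral_exp_sub_one_le ht0 ht) (h.abs_integral_mul_exp_sub_le ht0 ht)).trans ?_
  refine mul_le_mul_of_nonneg_right ?_ h0
  nlinarith [mul_nonneg ht0 h.pos.le]

lemma abs_conj_variance_sub_le (h : IsBernsteinLaw μ r) {t : ℝ} (ht0 : 0 ≤ t)
    (ht : t * r ≤ 1 / 1000) :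
    |(∫ x, (x - conjMean μ t) ^ 2 ∂(conjLaw μ t)) - ∫ x, x ^ 2 ∂μ| ≤
      151 * (t * r) * ∫ x, x ^ 2 ∂μ := by
  have := h.isProbabilityMeasure_conj (abs_mul_lt_one_of_le ht0 ht)
  set s := ∫ x, x ^ 2 ∂μ with hs
  set m := conjMean μ t with hm
  have hs0 : 0 ≤ s := integral_sq_nonneg
  have hθ : 0 ≤ t * r := mul_nonneg ht0 h.pos.le
  have hi1 : Integrable (fun x => x) (conjLaw μ t) :=
    h.integrable_conj_of_le ht0 ht measurable_id abs_le_one_add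
  have hi2 : Integrable (fun x => x ^ 2) (conjLaw μ t) :=
    h.integrable_conj_of_le ht0 ht (measurable_id.pow_const 2) abs_sq_le_one_add
  have e : ∫ x, (x - m) ^ 2 ∂(conjLaw μ t) = (∫ x, x ^ 2 ∂(conjLaw μ t)) - m ^ 2 := by
    have hi3 : Integrable (fun x => 2 * m * x - m ^ 2) (conjLaw μ t) :=
      (hi1.const_mul _).sub (integrable_const _)
    have e1 : ∀ x : ℝ, (x - m) ^ 2 = x ^ 2 - (2 * m * x - m ^ 2) := fun x => by ring
    simp_rw [e1]
    rw [integral_sub hi2 hi3, integral_sub (hi1.const_mul _) (integrable_const _),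
      integral_const_mul, ← conjMean, ← hm]
    simp
    ring
  have h2 : |(∫ x, x ^ 2 ∂(conjLaw μ t)) - s| ≤ 150 * (t * r) * s := by
    rw [integral_conjLaw]
    refine (abs_div_sub_le hs0 (h.one_le_integral_exp (abs_mul_lt_one_of_le ht0 ht))
      (h.integral_exp_sub_one_le ht0 ht) (h.abs_integral_sq_mul_exp_sub_le ht0 ht)).trans ?_
    refine mul_le_mul_of_nonneg_right ?_ hs0
    nlinarith
  -- `m ^ 2` is of smaller order, since `s ≤ 12 r ^ 2`
  have h3 : m ^ 2 ≤ (t * r) * s := by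
    have h4 := abs_le.1 (h.abs_conjMean_sub_le ht0 ht)
    rw [← hs, ← hm] at h4
    have h5 : 0 ≤ t * s := mul_nonneg ht0 hs0
    have h6 : |m| ≤ 2 * (t * s) := by
      rw [abs_le]; constructor <;> nlinarith
    have h7 : m ^ 2 ≤ 4 * (t * s) ^ 2 := by
      rw [← sq_abs]; nlinarith [abs_nonneg m]
    have h8 : t ^ 2 * s ≤ 12 * (t * r) ^ 2 := by
      have := mul_le_mul_of_nonneg_left h.integral_sq_le (sq_nonneg t)
      rw [← hs] at this
      linarith
    calc m ^ 2 ≤ 4 * (t ^ 2 * s) * s := by linarith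
      _ ≤ 4 * (12 * (t * r) ^ 2) * s := by gcongr
      _ ≤ (t * r) * s := mul_le_mul_of_nonneg_right (by nlinarith) hs0
  rw [e]
  have h4 := abs_le.1 h2
  rw [abs_le]
  constructor <;> nlinarith [sq_nonneg m]

lemma abs_sub_pow_three_le (x m : ℝ) : |x - m| ^ 3 ≤ 4 * (|x| ^ 3 + |m| ^ 3) := by
  have h1 : |x - m| ≤ |x| + |m| := abs_sub _ _
  have hx := abs_nonneg x
  have hm := abs_nonneg m
  calc |x - m| ^ 3 ≤ (|x| + |m|) ^ 3 := by gcongr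
    _ ≤ _ := by nlinarith [mul_nonneg (add_nonneg hx hm) (sq_nonneg (|x| - |m|))]

lemma integrable_conj_abs_sub_pow_three (h : IsBernsteinLaw μ r) {t : ℝ} (ht0 : 0 ≤ t)
    (ht : t * r ≤ 1 / 1000) (m : ℝ) : Integrable (fun x => |x - m| ^ 3) (conjLaw μ t) := by
  have := h.isProbabilityMeasure_conj (abs_mul_lt_one_of_le ht0 ht)
  have hi3 : Integrable (fun x => |x| ^ 3) (conjLaw μ t) :=
    h.integrable_conj_of_le ht0 ht (by fun_prop) abs_cube_le_one_add
  refine ((hi3.add (integrable_const (|m| ^ 3))).const_mul 4).mono' (by fun_prop)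
    (Eventually.of_forall fun x => ?_)
  rw [Real.norm_eq_abs, abs_of_nonneg (by positivity)]
  exact abs_sub_pow_three_le x m

/-- Jensen's inequality, by the tangent of `u ↦ u ^ 3` at `|E X|`. -/
lemma abs_integral_pow_three_le {ν : Measure ℝ} [IsProbabilityMeasure ν]
    (h1 : Integrable (fun x => x) ν) (h3 : Integrable (fun x => |x| ^ 3) ν) :
    |∫ x, x ∂ν| ^ 3 ≤ ∫ x, |x| ^ 3 ∂ν := by
  have hm1 : |∫ x, x ∂ν| ≤ ∫ x, |x| ∂ν := abs_integral_le_integral_abs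
  generalize |∫ x, x ∂ν| = m at hm1 ⊢
  by_cases hm : 0 ≤ m
  · have h4 : ∫ x, (3 * m ^ 2 * |x| - 2 * m ^ 3) ∂ν ≤ ∫ x, |x| ^ 3 ∂ν := by
      refine integral_mono ((h1.abs.const_mul _).sub (integrable_const _)) h3 fun x => ?_
      have hx := abs_nonneg x
      nlinarith [mul_nonneg (add_nonneg hx (add_nonneg hm hm)) (sq_nonneg (|x| - m))]
    rw [integral_sub (h1.abs.const_mul _) (integrable_const _), integral_const_mul] at h4
    simp only [integral_const, probReal_univ, one_smul] at h4
    have := mul_le_mul_of_nonneg_left hm1 (show 0 ≤ 3 * m ^ 2 by positivity)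
    linarith
  · have : m ^ 3 < 0 := Odd.pow_neg ⟨1, rfl⟩ (not_le.1 hm)
    exact this.le.trans (integral_nonneg fun x => by positivity)

lemma integral_conj_abs_sub_pow_three_le (h : IsBernsteinLaw μ r) {t : ℝ} (ht0 : 0 ≤ t)
    (ht : t * r ≤ 1 / 1000) :
    ∫ x, |x - conjMean μ t| ^ 3 ∂(conjLaw μ t) ≤ 1136 * r * ∫ x, x ^ 2 ∂μ := by
  have := h.isProbabilityMeasure_conj (abs_mul_lt_one_of_le ht0 ht)
  have hi1 : Integrable (fun x => x) (conjLaw μ t) :=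
    h.integrable_conj_of_le ht0 ht measurable_id abs_le_one_add
  have hi3 : Integrable (fun x => |x| ^ 3) (conjLaw μ t) :=
    h.integrable_conj_of_le ht0 ht (by fun_prop) abs_cube_le_one_add
  set m := conjMean μ t with hm
  have h1 : ∫ x, |x| ^ 3 ∂(conjLaw μ t) ≤ 142 * r * ∫ x, x ^ 2 ∂μ := by
    have hD := h.one_le_integral_exp (abs_mul_lt_one_of_le ht0 ht)
    rw [integral_conjLaw, div_le_iff₀ (by linarith)]
    have h0 : ∫ x, Real.exp (t * x) * |x| ^ 3 ∂μ ≤ 142 * r * ∫ x, x ^ 2 ∂μ := by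
      refine le_trans (integral_mono (h.integrable_exp_mul_of_le ht0 ht (by fun_prop)
        abs_cube_le_one_add) h.integrable_pow_three_mul_exp fun x => ?_)
        h.integral_pow_three_mul_exp_le
      simp only
      rw [mul_comm]
      exact mul_le_mul_of_nonneg_left (h.exp_mul_le ht0 ht x) (by positivity)
    refine h0.trans (le_mul_of_one_le_right ?_ hD)
    exact mul_nonneg (by linarith [h.pos]) integral_sq_nonneg
  have h2 : |m| ^ 3 ≤ ∫ x, |x| ^ 3 ∂(conjLaw μ t) := abs_integral_pow_three_le hi1 hi3
  have h4 : ∫ x, |x - m| ^ 3 ∂(conjLaw μ t) ≤ ∫ x, 4 * (|x| ^ 3 + |m| ^ 3) ∂(conjLaw μ t) :=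
    integral_mono (h.integrable_conj_abs_sub_pow_three ht0 ht m)
      ((hi3.add (integrable_const _)).const_mul 4) fun x => abs_sub_pow_three_le x m
  have h5 : ∫ x, 4 * (|x| ^ 3 + |m| ^ 3) ∂(conjLaw μ t) =
      4 * ((∫ x, |x| ^ 3 ∂(conjLaw μ t)) + |m| ^ 3) := by
    rw [integral_const_mul, integral_add hi3 (integrable_const _), integral_const, probReal_univ,
      one_smul]
  linarith

/-- The tangent inequality for the convex function `t ↦ log E exp (t ξ)`. -/
lemma integral_exp_mul_exp_le (h : IsBernsteinLaw μ r) {t t' : ℝ} (ht0 : 0 ≤ t)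
    (ht : t * r ≤ 1 / 1000) (ht' : |t'| * r < 1) :
    (∫ x, Real.exp (t * x) ∂μ) * Real.exp ((t' - t) * conjMean μ t) ≤
      ∫ x, Real.exp (t' * x) ∂μ := by
  have ht1 := abs_mul_lt_one_of_le ht0 ht
  have := h.isProbabilityMeasure_conj ht1
  have hD := h.one_le_integral_exp ht1
  set m := conjMean μ t with hm
  have hi1 : Integrable (fun x => x) (conjLaw μ t) :=
    h.integrable_conj_of_le ht0 ht measurable_id abs_le_one_add
  have e : ∀ x : ℝ, Real.exp (t * x) * Real.exp ((t' - t) * x) = Real.exp (t' * x) := fun x => by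
    rw [← Real.exp_add]; congr 1; ring
  have hie : Integrable (fun x => Real.exp ((t' - t) * x)) (conjLaw μ t) := by
    rw [conjLaw, integrable_tilted_iff (h.integrable_exp ht1)]
    simp_rw [smul_eq_mul, e]
    exact h.integrable_exp ht'
  have h1 : ∫ x, Real.exp ((t' - t) * x) ∂(conjLaw μ t) =
      (∫ x, Real.exp (t' * x) ∂μ) / ∫ x, Real.exp (t * x) ∂μ := by
    rw [integral_conjLaw]
    simp_rw [e]
  have h2 : Real.exp ((t' - t) * m) ≤ ∫ x, Real.exp ((t' - t) * x) ∂(conjLaw μ t) := by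
    set c := t' - t with hc
    have hi2 : Integrable (fun x => Real.exp (c * m) * (c * x + (1 - c * m))) (conjLaw μ t) :=
      ((hi1.const_mul c).add (integrable_const _)).const_mul _
    calc Real.exp (c * m) = ∫ x, Real.exp (c * m) * (c * x + (1 - c * m)) ∂(conjLaw μ t) := by
          rw [integral_const_mul, integral_add (hi1.const_mul c) (integrable_const _),
            integral_const_mul, ← conjMean, ← hm]
          simp
      _ ≤ _ := by
          refine integral_mono hi2 hie fun x => ?_
          have h3 := Real.add_one_le_exp (c * x - c * m)
          calc Real.exp (c * m) * (c * x + (1 - c * m))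
              ≤ Real.exp (c * m) * Real.exp (c * x - c * m) := by
                gcongr; linarith
            _ = Real.exp (c * x) := by rw [← Real.exp_add]; congr 1; ring
  rw [h1, le_div_iff₀ (by linarith)] at h2
  linarith

end IsBernsteinLaw

/-! ### Comparison of exponential functionals with their Gaussian values -/

lemma measureReal_Ioc_eq {ν : Measure ℝ} [IsProbabilityMeasure ν] {a b : ℝ} (hab : a ≤ b) :
    ν.real (Set.Ioc a b) = ν.real (Set.Iic b) - ν.real (Set.Iic a) := by
  rw [← Set.Iic_sdiff_Iic, measureReal_sdiff (Set.Iic_subset_Iic.2 hab) measurableSet_Iic]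

lemma measureReal_Ioi_eq {ν : Measure ℝ} [IsProbabilityMeasure ν] (a : ℝ) :
    ν.real (Set.Ioi a) = 1 - ν.real (Set.Iic a) := by
  rw [← Set.compl_Iic, probReal_compl_eq_one_sub measurableSet_Iic]

/-- The super-level sets of `y ↦ 1_{y > 0} exp (-a y)` are intervals, so their measures differ by at
most twice the Kolmogorov distance of the laws. -/
lemma measureReal_le_indicator_exp {ν ν' : Measure ℝ} [IsProbabilityMeasure ν]
    [IsProbabilityMeasure ν'] {K : ℝ} (h : ∀ z, |ν.real (Set.Iic z) - ν'.real (Set.Iic z)| ≤ K)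
    {a : ℝ} (ha : 0 ≤ a) {t : ℝ} (ht : t ∈ Set.Ioc (0 : ℝ) 1) :
    ν.real {y | t ≤ (Set.Ioi (0 : ℝ)).indicator (fun y => Real.exp (-(a * y))) y} ≤
      ν'.real {y | t ≤ (Set.Ioi (0 : ℝ)).indicator (fun y => Real.exp (-(a * y))) y} + 2 * K := by
  have hmem : ∀ y, t ≤ (Set.Ioi (0 : ℝ)).indicator (fun y => Real.exp (-(a * y))) y ↔
      0 < y ∧ a * y ≤ -Real.log t := fun y => by
    by_cases hy : y ∈ Set.Ioi (0 : ℝ)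
    · rw [Set.indicator_of_mem hy, ← Real.log_le_iff_le_exp ht.1]
      exact ⟨fun h => ⟨hy, by linarith⟩, fun h => by linarith [h.2]⟩
    · rw [Set.indicator_of_notMem hy]
      exact ⟨fun h => absurd ht.1 (not_lt.2 h), fun h => absurd h.1 hy⟩
  simp_rw [hmem]
  have hlog : 0 ≤ -Real.log t := by linarith [Real.log_nonpos ht.1.le ht.2]
  have h0 := abs_le.1 (h 0)
  rcases ha.eq_or_lt with rfl | ha
  · have e : {y : ℝ | 0 < y ∧ 0 * y ≤ -Real.log t} = Set.Ioi 0 := by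
      ext y; simp [Real.log_nonpos ht.1.le ht.2]
    rw [e, measureReal_Ioi_eq, measureReal_Ioi_eq]
    have : 0 ≤ K := (abs_nonneg _).trans (h 0)
    linarith
  · have e : {y : ℝ | 0 < y ∧ a * y ≤ -Real.log t} = Set.Ioc 0 (-Real.log t / a) := by
      ext y
      simp only [Set.mem_ofPred_eq, Set.mem_Ioc, le_div_iff₀ ha, mul_comm a]
    have hb : 0 ≤ -Real.log t / a := by positivity
    rw [e, measureReal_Ioc_eq hb, measureReal_Ioc_eq hb]
    have h1 := abs_le.1 (h (-Real.log t / a))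
    linarith

/-- The layer cake formula integrates the comparison of super-level sets. -/
lemma integral_indicator_exp_le {ν ν' : Measure ℝ} [IsProbabilityMeasure ν]
    [IsProbabilityMeasure ν'] {K : ℝ} (h : ∀ z, |ν.real (Set.Iic z) - ν'.real (Set.Iic z)| ≤ K)
    {a : ℝ} (ha : 0 ≤ a) :
    ∫ y, (Set.Ioi (0 : ℝ)).indicator (fun y => Real.exp (-(a * y))) y ∂ν ≤
      (∫ y, (Set.Ioi (0 : ℝ)).indicator (fun y => Real.exp (-(a * y))) y ∂ν') + 2 * K := by
  set g : ℝ → ℝ := (Set.Ioi (0 : ℝ)).indicator (fun y => Real.exp (-(a * y))) with hg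
  have hgm : Measurable g := Measurable.indicator (by fun_prop) measurableSet_Ioi
  have hg0 : ∀ y, 0 ≤ g y := fun y => Set.indicator_nonneg (fun y _ => (Real.exp_pos _).le) y
  have hg1 : ∀ y, g y ≤ 1 := fun y => by
    refine Set.indicator_le' (g := fun _ => (1 : ℝ)) (fun y hy => ?_) (fun _ _ => zero_le_one) y
    have : 0 < y := hy
    rw [Real.exp_le_one_iff]
    nlinarith
  have hgi (ρ : Measure ℝ) [IsProbabilityMeasure ρ] : Integrable g ρ :=
    Integrable.of_bound hgm.aestronglyMeasurable 1 (Eventually.of_forall fun y => by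
      rw [Real.norm_eq_abs, abs_of_nonneg (hg0 y)]; exact hg1 y)
  have hlc (ρ : Measure ℝ) [IsProbabilityMeasure ρ] :
      ∫ y, g y ∂ρ = ∫ t in Set.Ioc (0 : ℝ) 1, ρ.real {y | t ≤ g y} :=
    (hgi ρ).integral_eq_integral_Ioc_meas_le (Eventually.of_forall hg0) (Eventually.of_forall hg1)
  have hint (ρ : Measure ℝ) [IsProbabilityMeasure ρ] :
      IntegrableOn (fun t => ρ.real {y | t ≤ g y}) (Set.Ioc 0 1) := by
    have hanti : Antitone (fun t => ρ.real {y | t ≤ g y}) := fun s t hst =>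
      measureReal_mono fun y (hy : t ≤ g y) => hst.trans hy
    exact (hanti.locallyIntegrable.integrableOn_isCompact isCompact_Icc).mono_set
      Set.Ioc_subset_Icc_self
  rw [hlc ν, hlc ν']
  calc _ ≤ ∫ t in Set.Ioc (0 : ℝ) 1, (ν'.real {y | t ≤ g y} + 2 * K) :=
        setIntegral_mono_on (hint ν) ((hint ν').add (integrable_const (2 * K))) measurableSet_Ioc
          fun t ht => measureReal_le_indicator_exp h ha ht
    _ = _ := by
        rw [integral_add (hint ν') (integrable_const (2 * K))]
        simp

/-! ### Conjugate product measures -/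

section Product

variable {ι : Type*} [Fintype ι] {μ : ι → Measure ℝ} [∀ i, IsProbabilityMeasure (μ i)] {r : ℝ}

lemma integral_exp_sum_pi (μ : ι → Measure ℝ) [∀ i, IsProbabilityMeasure (μ i)] (t : ℝ) :
    ∫ x, Real.exp (t * ∑ i, x i) ∂(Measure.pi μ) = ∏ i, ∫ y, Real.exp (t * y) ∂(μ i) := by
  rw [← integral_fintype_prod_eq_prod (fun _ y => Real.exp (t * y))]
  congr 1
  ext x
  rw [Finset.mul_sum, Real.exp_sum]

lemma integrable_exp_sum_pi (h : ∀ i, IsBernsteinLaw (μ i) r) {t : ℝ} (ht : |t| * r < 1) :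
    Integrable (fun x : ι → ℝ => Real.exp (t * ∑ i, x i)) (Measure.pi μ) := by
  have := Integrable.fintype_prod (f := fun _ y => Real.exp (t * y))
    (fun i => (h i).integrable_exp ht)
  refine this.congr (Eventually.of_forall fun x => ?_)
  simp only
  rw [Finset.mul_sum, Real.exp_sum]

lemma tilted_pi (h : ∀ i, IsBernsteinLaw (μ i) r) {t : ℝ} (ht : |t| * r < 1) :
    (Measure.pi μ).tilted (fun x => t * ∑ i, x i) = Measure.pi (fun i => conjLaw (μ i) t) := by
  have := fun i => (h i).isProbabilityMeasure_conj ht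
  symm
  refine Measure.pi_eq fun s hs => ?_
  rw [tilted_apply_eq_ofReal_integral' _ (MeasurableSet.univ_pi hs)]
  have e : ∀ i, conjLaw (μ i) t (s i) =
      ENNReal.ofReal (∫ y, (s i).indicator
        (fun y => Real.exp (t * y) / ∫ z, Real.exp (t * z) ∂(μ i)) y ∂(μ i)) := fun i => by
    rw [conjLaw, tilted_apply_eq_ofReal_integral' _ (hs i), integral_indicator (hs i)]
  simp_rw [e]
  rw [← ENNReal.ofReal_prod_of_nonneg, ← integral_fintype_prod_eq_prod,
    ← integral_indicator (MeasurableSet.univ_pi hs)]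
  · congr 2
    ext x
    by_cases hx : x ∈ Set.univ.pi s
    · rw [Set.indicator_of_mem hx, integral_exp_sum_pi, Finset.mul_sum, Real.exp_sum,
        ← Finset.prod_div_distrib]
      exact Finset.prod_congr rfl fun i _ => by rw [Set.indicator_of_mem (hx i trivial)]
    · rw [Set.indicator_of_notMem hx]
      obtain ⟨i, hi⟩ : ∃ i, x i ∉ s i := by simpa using hx
      exact (Finset.prod_eq_zero (Finset.mem_univ i) (by rw [Set.indicator_of_notMem hi])).symm
  · intro i _
    refine integral_nonneg fun y => Set.indicator_nonneg (fun y _ => ?_) y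
    exact div_nonneg (Real.exp_pos _).le (integral_nonneg fun _ => (Real.exp_pos _).le)

/-- The tail probability as an exponential functional of the sum under the conjugate product. -/
lemma measureReal_sum_gt_eq (h : ∀ i, IsBernsteinLaw (μ i) r) {t : ℝ} (ht : |t| * r < 1) (x : ℝ) :
    (Measure.pi μ).real {ω | x < ∑ i, ω i} =
      (∏ i, ∫ y, Real.exp (t * y) ∂(μ i)) * Real.exp (-(t * x)) *
        ∫ ω, (Set.Ioi (0 : ℝ)).indicator (fun y => Real.exp (-(t * y))) ((∑ i, ω i) - x)
          ∂(Measure.pi fun i => conjLaw (μ i) t) := by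
  have hD : 0 < ∏ i, ∫ y, Real.exp (t * y) ∂(μ i) :=
    Finset.prod_pos fun i _ => by linarith [(h i).one_le_integral_exp ht]
  have hm : MeasurableSet {ω : ι → ℝ | x < ∑ i, ω i} :=
    measurableSet_lt measurable_const (by fun_prop)
  have hpt : ∀ ω : ι → ℝ, (Real.exp (t * ∑ i, ω i) / ∏ i, ∫ y, Real.exp (t * y) ∂(μ i)) •
      (Set.Ioi (0 : ℝ)).indicator (fun y => Real.exp (-(t * y))) ((∑ i, ω i) - x) =
      {ω : ι → ℝ | x < ∑ i, ω i}.indicator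
        (fun _ => Real.exp (t * x) / ∏ i, ∫ y, Real.exp (t * y) ∂(μ i)) ω := fun ω => by
    by_cases hω : x < ∑ i, ω i
    · rw [Set.indicator_of_mem (show _ ∈ Set.Ioi (0 : ℝ) from sub_pos.2 hω),
        Set.indicator_of_mem (show ω ∈ {ω : ι → ℝ | x < ∑ i, ω i} from hω), smul_eq_mul,
        div_mul_eq_mul_div, ← Real.exp_add]
      congr 2
      ring
    · rw [Set.indicator_of_notMem (show _ ∉ Set.Ioi (0 : ℝ) from fun h' => hω (sub_pos.1 h')),
        Set.indicator_of_notMem (show ω ∉ {ω : ι → ℝ | x < ∑ i, ω i} from hω), smul_zero]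
  rw [← tilted_pi h ht, integral_tilted, integral_exp_sum_pi]
  simp_rw [hpt]
  rw [integral_indicator_const _ hm, smul_eq_mul, Real.exp_neg]
  field_simp

end Product

/-! ### The function `xTilde` -/

lemma xTilde_nonneg {δ r x : ℝ} (hx : 0 ≤ x) : 0 ≤ xTilde δ r x :=
  div_nonneg (by linarith) (by positivity)

/-- `xTilde δ r x` is the nonnegative solution `b` of `x = b + (1 + δ) r b² / 2`. -/
lemma xTilde_spec {δ r x : ℝ} (hδ : 0 ≤ δ) (hr : 0 < r) (hx : 0 ≤ x) :
    x = xTilde δ r x + (1 + δ) * r * xTilde δ r x ^ 2 / 2 := by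
  have h0 : 0 ≤ 1 + 2 * (1 + δ) * x * r := by positivity
  have hsq := Real.sq_sqrt h0
  have hs := Real.sqrt_nonneg (1 + 2 * (1 + δ) * x * r)
  rw [xTilde]
  set w := √(1 + 2 * (1 + δ) * x * r)
  have hw : 1 + w ≠ 0 := by positivity
  field_simp
  linear_combination x * hsq

lemma xTilde_le_self {δ r x : ℝ} (hδ : 0 ≤ δ) (hr : 0 < r) (hx : 0 ≤ x) : xTilde δ r x ≤ x := by
  have h := xTilde_spec hδ hr hx
  have : 0 ≤ (1 + δ) * r * xTilde δ r x ^ 2 / 2 := by positivity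
  linarith

lemma xTilde_le_xTilde_zero {δ r x : ℝ} (hδ : 0 ≤ δ) (hr : 0 < r) (hx : 0 ≤ x) :
    xTilde δ r x ≤ xTilde 0 r x := by
  rw [xTilde, xTilde]
  have : 2 * (1 + 0) * x * r ≤ 2 * (1 + δ) * x * r := by gcongr
  gcongr

/-- Where `r x` is bounded below, replacing `0` by `δ > 0` in `xTilde` costs an exponent of order
`1 / r²`. -/
lemma le_xTilde_zero_sq_sub {δ r x : ℝ} (hδ : 0 < δ) (hδ1 : δ ≤ 1) (hr : 0 < r) (hx : 0 ≤ x)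
    (hxr : 1 / 2000 < x * r) :
    δ / (4 * 4000 ^ 3) ≤ (xTilde 0 r x ^ 2 - xTilde δ r x ^ 2) / 2 * r ^ 2 := by
  have h1 := xTilde_spec hδ.le hr hx
  have h2 := xTilde_spec le_rfl hr hx
  have hb := xTilde_nonneg (δ := δ) (r := r) hx
  have hba := xTilde_le_xTilde_zero hδ.le hr hx
  set b := xTilde δ r x
  set a := xTilde 0 r x
  set y := r * b with hy
  have hy0 : 0 ≤ y := mul_nonneg hr.le hb
  have hylow : 1 / 4000 ≤ y := by
    by_contra hc
    have hc := not_le.1 hc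
    have : x * r = y + (1 + δ) * y ^ 2 / 2 := by rw [h1, hy]; ring
    nlinarith
  -- the equations defining `a` and `b` have the same left-hand side `x`; subtract them
  have e : (a ^ 2 - b ^ 2) / 2 * (1 + r * (a + b) / 2) = (a + b) * (δ * r * b ^ 2) / 4 := by
    have : (a - b) * (1 + r * (a + b) / 2) = δ * r * b ^ 2 / 2 := by linarith
    calc _ = (a + b) / 2 * ((a - b) * (1 + r * (a + b) / 2)) := by ring
      _ = _ := by rw [this]; ring
  have hmono : 2 * b * (1 + r * (a + b) / 2) ≤ (a + b) * (1 + y) := by nlinarith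
  have hpos : 0 < 1 + r * (a + b) / 2 := by
    have : 0 ≤ r * (a + b) := mul_nonneg hr.le (by linarith)
    linarith
  have hD : δ * y ^ 3 / 2 ≤ (a ^ 2 - b ^ 2) / 2 * r ^ 2 * (1 + y) := by
    refine le_of_mul_le_mul_right ?_ hpos
    calc δ * y ^ 3 / 2 * (1 + r * (a + b) / 2)
        = (δ * r ^ 3 * b ^ 2 / 4) * (2 * b * (1 + r * (a + b) / 2)) := by rw [hy]; ring
      _ ≤ (δ * r ^ 3 * b ^ 2 / 4) * ((a + b) * (1 + y)) :=
          mul_le_mul_of_nonneg_left hmono (by positivity)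
      _ = ((a + b) * (δ * r * b ^ 2) / 4) * (r ^ 2 * (1 + y)) := by ring
      _ = _ := by rw [← e]; ring
  have hy3 : (1 / 4000 : ℝ) ^ 3 * (1 + y) ≤ 2 * y ^ 3 := by
    have h3 : (1 / 4000 : ℝ) ^ 3 ≤ y ^ 3 := by gcongr
    have h4 : (1 / 4000 : ℝ) ^ 3 ≤ y ^ 2 :=
      le_trans (by norm_num) (pow_le_pow_left₀ (by norm_num) hylow 2)
    nlinarith
  have : δ / (4 * 4000 ^ 3) * (1 + y) ≤ (a ^ 2 - b ^ 2) / 2 * r ^ 2 * (1 + y) := by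
    refine le_trans ?_ hD
    have := mul_le_mul_of_nonneg_left hy3 hδ.le
    norm_num at this ⊢
    linarith
  exact le_of_mul_le_mul_right this (by linarith)

/-! ### Bernstein's exponential inequality and large deviations -/

section Normalized

variable {ι : Type*} [Fintype ι] {μ : ι → Measure ℝ} [∀ i, IsProbabilityMeasure (μ i)] {r : ℝ}

/-- Bernstein's exponential bound with its optimal parameter. -/
lemma prod_integral_exp_mul_le (h : ∀ i, IsBernsteinLaw (μ i) r) (hr : 0 < r)
    (hs : ∑ i, ∫ y, y ^ 2 ∂(μ i) = 1) {x : ℝ} (hx : 0 ≤ x) :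
    (∏ i, ∫ y, Real.exp (xTilde 0 r x / (1 + r * xTilde 0 r x) * y) ∂(μ i)) *
        Real.exp (-(xTilde 0 r x / (1 + r * xTilde 0 r x) * x)) ≤
      Real.exp (-xTilde 0 r x ^ 2 / 2) := by
  have hspec := xTilde_spec le_rfl hr hx
  have ha := xTilde_nonneg (δ := 0) (r := r) hx
  set a := xTilde 0 r x
  have hden : 0 < 1 + r * a := by positivity
  set t := a / (1 + r * a) with ht
  have ht0 : 0 ≤ t := by positivity
  have e1 : 1 - t * r = 1 / (1 + r * a) := by rw [ht]; field_simp; ring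
  have htr : t * r < 1 := by
    have : 0 < 1 - t * r := by rw [e1]; positivity
    linarith
  have h1 : ∀ i, ∫ y, Real.exp (t * y) ∂(μ i) ≤
      Real.exp (t ^ 2 / (2 * (1 - t * r)) * ∫ y, y ^ 2 ∂(μ i)) := fun i => by
    refine ((h i).integral_exp_le ht0 htr).trans ?_
    have := Real.add_one_le_exp (t ^ 2 / (2 * (1 - t * r)) * ∫ y, y ^ 2 ∂(μ i))
    refine le_trans (le_of_eq ?_) this
    ring
  calc _ ≤ (∏ i, Real.exp (t ^ 2 / (2 * (1 - t * r)) * ∫ y, y ^ 2 ∂(μ i))) *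
        Real.exp (-(t * x)) := by
        refine mul_le_mul_of_nonneg_right (Finset.prod_le_prod (fun i _ => ?_) fun i _ => h1 i)
          (Real.exp_pos _).le
        exact integral_nonneg fun _ => (Real.exp_pos _).le
    _ = Real.exp (-a ^ 2 / 2) := by
        rw [← Real.exp_sum, ← Finset.mul_sum, hs, mul_one, ← Real.exp_add]
        congr 1
        rw [e1, ht, hspec]
        field_simp
        ring

lemma measureReal_sum_gt_le_exp (h : ∀ i, IsBernsteinLaw (μ i) r) (hr : 0 < r)
    (hs : ∑ i, ∫ y, y ^ 2 ∂(μ i) = 1) {x : ℝ} (hx : 0 ≤ x) :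
    (Measure.pi μ).real {ω | x < ∑ i, ω i} ≤ Real.exp (-xTilde 0 r x ^ 2 / 2) := by
  have h0 := prod_integral_exp_mul_le h hr hs hx
  have ha := xTilde_nonneg (δ := 0) (r := r) hx
  generalize xTilde 0 r x = a at h0 ha ⊢
  have hden : 0 < 1 + r * a := by positivity
  have htr : |a / (1 + r * a)| * r < 1 := by
    rw [abs_of_nonneg (by positivity), div_mul_eq_mul_div, div_lt_one hden]; linarith
  have ht0 : 0 ≤ a / (1 + r * a) := by positivity
  generalize a / (1 + r * a) = t at h0 htr ht0
  have h1 : (Measure.pi μ).real {ω | x ≤ ∑ i, ω i} ≤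
      Real.exp (-t * x) * mgf (fun ω : ι → ℝ => ∑ i, ω i) (Measure.pi μ) t :=
    measure_ge_le_exp_mul_mgf x ht0 (integrable_exp_sum_pi h htr)
  have h2 : mgf (fun ω : ι → ℝ => ∑ i, ω i) (Measure.pi μ) t =
      ∏ i, ∫ y, Real.exp (t * y) ∂(μ i) := integral_exp_sum_pi μ t
  have h3 : (Measure.pi μ).real {ω | x < ∑ i, ω i} ≤ (Measure.pi μ).real {ω | x ≤ ∑ i, ω i} :=
    measureReal_mono fun ω (hω : x < ∑ i, ω i) => hω.le
  rw [h2, neg_mul, mul_comm] at h1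
  exact h3.trans (h1.trans h0)

lemma exp_le_mul_one_sub_stdNormalCDF {b : ℝ} (hb : 0 ≤ b) :
    Real.exp (-b ^ 2 / 2) ≤ 15 * (1 + b) * (1 - stdNormalCDF b) := by
  have h1 := le_mills hb
  have h2 : √(2 * Real.pi) ≤ 3 := by
    rw [Real.sqrt_le_left (by norm_num)]
    linarith [Real.pi_lt_d2]
  have h3 := sqrt_two_pi_pos
  rw [one_sub_stdNormalCDF]
  rw [div_le_iff₀ (by positivity)] at h1
  have h4 : 1 ≤ 3 * (√(2 * Real.pi))⁻¹ := by
    rw [← div_eq_mul_inv, one_le_div h3]; exact h2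
  have h5 : 0 ≤ mills b * (5 * (1 + b)) := by linarith
  calc Real.exp (-b ^ 2 / 2) ≤ Real.exp (-b ^ 2 / 2) * ((3 * (√(2 * Real.pi))⁻¹) *
        (mills b * (5 * (1 + b)))) := by
        refine le_mul_of_one_le_right (Real.exp_pos _).le ?_
        nlinarith
    _ = _ := by ring

/-- Large deviations: the gain from `δ > 0` in the exponent absorbs the factor `r`. -/
lemma measureReal_sum_gt_le_of_large (h : ∀ i, IsBernsteinLaw (μ i) r) (hr : 0 < r)
    (hs : ∑ i, ∫ y, y ^ 2 ∂(μ i) = 1) {δ : ℝ} (hδ : 0 < δ) (hδ1 : δ ≤ 1) {x : ℝ} (hx : 0 ≤ x)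
    (hxr : 1 / 2000 < x * r) :
    (Measure.pi μ).real {ω | x < ∑ i, ω i} ≤
      (1 - stdNormalCDF (xTilde δ r x)) *
        (1 + 15 * (4 * 4000 ^ 3 / δ) * (1 + xTilde δ r x) * r) := by
  have h1 := measureReal_sum_gt_le_exp h hr hs hx
  have h2 := le_xTilde_zero_sq_sub hδ hδ1 hr hx hxr
  have hb := xTilde_nonneg (δ := δ) (r := r) hx
  have h3 := exp_le_mul_one_sub_stdNormalCDF hb
  have h4 := stdNormalCDF_le_one (xTilde δ r x)
  set a := xTilde 0 r x
  set b := xTilde δ r x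
  set D := (a ^ 2 - b ^ 2) / 2 with hD
  set κ := δ / (4 * 4000 ^ 3) with hκ
  have hκ0 : 0 < κ := by positivity
  have hκ1 : κ ≤ 1 := by rw [hκ, div_le_one (by norm_num)]; linarith
  have hD0 : 0 < D := by
    by_contra hc
    nlinarith [mul_nonneg (neg_nonneg.2 (not_lt.1 hc)) (sq_nonneg r)]
  -- `exp D ≥ 1 + D` and `D r² ≥ κ` give `r exp D ≥ κ`, whether `r ≥ κ` or not
  have hexp : Real.exp (-D) ≤ r / κ := by
    have h5 : κ ≤ r * (1 + D) := by
      rcases le_total κ r with hk | hk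
      · nlinarith
      · refine le_of_mul_le_mul_right (a := r) ?_ hr
        nlinarith
    rw [Real.exp_neg, le_div_iff₀ hκ0, inv_mul_le_iff₀ (Real.exp_pos _)]
    have h6 := Real.add_one_le_exp D
    nlinarith
  have e : 15 * (4 * 4000 ^ 3 / δ) * (1 + b) * r = 15 * (1 + b) * (r / κ) := by
    rw [hκ]; field_simp
  calc _ ≤ Real.exp (-a ^ 2 / 2) := h1
    _ = Real.exp (-b ^ 2 / 2) * Real.exp (-D) := by
        rw [← Real.exp_add, hD]; congr 1; ring
    _ ≤ (15 * (1 + b) * (1 - stdNormalCDF b)) * (r / κ) := by gcongr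
    _ ≤ _ := by rw [e]; linarith

end Normalized

/-! ### The saddle point method for moderate deviations -/

section SaddlePoint

variable {ι : Type*} [Fintype ι] {μ : ι → Measure ℝ} [∀ i, IsProbabilityMeasure (μ i)] {r : ℝ}

lemma abs_sum_conjMean_sub_le (h : ∀ i, IsBernsteinLaw (μ i) r)
    (hs : ∑ i, ∫ y, y ^ 2 ∂(μ i) = 1) {t : ℝ} (ht0 : 0 ≤ t) (ht : t * r ≤ 1 / 1000) :
    |(∑ i, conjMean (μ i) t) - t| ≤ 150 * (t * r) * t := by
  have e : (∑ i, conjMean (μ i) t) - t =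
      ∑ i, (conjMean (μ i) t - t * ∫ y, y ^ 2 ∂(μ i)) := by
    rw [Finset.sum_sub_distrib, ← Finset.mul_sum, hs, mul_one]
  rw [e]
  calc _ ≤ ∑ i, 150 * (t * r) * (t * ∫ y, y ^ 2 ∂(μ i)) :=
        (Finset.abs_sum_le_sum_abs _ _).trans
          (Finset.sum_le_sum fun i _ => (h i).abs_conjMean_sub_le ht0 ht)
    _ = _ := by rw [← Finset.mul_sum, ← Finset.mul_sum, hs, mul_one]

/-- Existence of the saddle point: the parameter for which the conjugate mean of the sum
is `x`. -/
lemma exists_sum_conjMean_eq (h : ∀ i, IsBernsteinLaw (μ i) r) (hr : 0 < r)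
    (hs : ∑ i, ∫ y, y ^ 2 ∂(μ i) = 1) {x : ℝ} (hx : 0 ≤ x) (hxr : x * r ≤ 1 / 2000) :
    ∃ t, 0 ≤ t ∧ t * r ≤ 1 / 1000 ∧ ∑ i, conjMean (μ i) t = x := by
  have hT : 0 ≤ 1 / (1000 * r) := by positivity
  have hTr : 1 / (1000 * r) * r = 1 / 1000 := by field_simp
  have hc : ContinuousOn (fun t => ∑ i, conjMean (μ i) t) (Set.Icc 0 (1 / (1000 * r))) :=
    continuousOn_finsetSum _ fun i _ => (h i).continuousOn_conjMean
  have h0 := abs_sum_conjMean_sub_le h hs le_rfl (by norm_num : (0 : ℝ) * r ≤ 1 / 1000)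
  have h1 := abs_le.1 (abs_sum_conjMean_sub_le h hs hT hTr.le)
  rw [hTr] at h1
  have h00 : ∑ i, conjMean (μ i) 0 = 0 := by simpa using h0
  have hxT : x ≤ 1 / (1000 * r) / 2 := by
    rw [div_div, le_div_iff₀ (by positivity)]; linarith
  obtain ⟨t, ht, htx⟩ := intermediate_value_Icc hT hc
    (show x ∈ Set.Icc _ _ from ⟨by simpa only [h00] using hx, by linarith [h1.1]⟩)
  refine ⟨t, ht.1, ?_, htx⟩
  rw [← hTr]
  exact mul_le_mul_of_nonneg_right ht.2 hr.le

lemma abs_sum_conj_variance_sub_le (h : ∀ i, IsBernsteinLaw (μ i) r)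
    (hs : ∑ i, ∫ y, y ^ 2 ∂(μ i) = 1) {t : ℝ} (ht0 : 0 ≤ t) (ht : t * r ≤ 1 / 1000) :
    |(∑ i, ∫ y, (y - conjMean (μ i) t) ^ 2 ∂(conjLaw (μ i) t)) - 1| ≤ 151 * (t * r) := by
  rw [← hs, ← Finset.sum_sub_distrib]
  calc _ ≤ ∑ i, 151 * (t * r) * ∫ y, y ^ 2 ∂(μ i) :=
        (Finset.abs_sum_le_sum_abs _ _).trans
          (Finset.sum_le_sum fun i _ => (h i).abs_conj_variance_sub_le ht0 ht)
    _ = _ := by rw [← Finset.mul_sum, hs, mul_one]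

lemma integral_comp_eval_pi {ν : ι → Measure ℝ} [∀ i, IsProbabilityMeasure (ν i)] (i : ι)
    {g : ℝ → ℝ} (hg : Measurable g) :
    ∫ ω, g (ω i) ∂(Measure.pi ν) = ∫ y, g y ∂(ν i) :=
  integral_comp_eval hg.aestronglyMeasurable

/-- The sum, centered and normalized under the conjugate product law, is nearly Gaussian. -/
lemma conj_berry_esseen (h : ∀ i, IsBernsteinLaw (μ i) r)
    (hs : ∑ i, ∫ y, y ^ 2 ∂(μ i) = 1) {t : ℝ} (ht0 : 0 ≤ t) (ht : t * r ≤ 1 / 1000) {v : ℝ}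
    (hv0 : 0 < v)
    (hv : ∑ i, ∫ y, (y - conjMean (μ i) t) ^ 2 ∂(conjLaw (μ i) t) = v ^ 2) (z : ℝ) :
    |(Measure.pi fun i => conjLaw (μ i) t).real
        {ω | ((∑ i, ω i) - ∑ i, conjMean (μ i) t) / v ≤ z} - stdNormalCDF z| ≤
      52 * (1136 * r / v ^ 3) := by
  have hP := fun i => (h i).isProbabilityMeasure_conj (abs_mul_lt_one_of_le ht0 ht)
  set Q := Measure.pi fun i => conjLaw (μ i) t with hQ
  have hfm : ∀ i, Measurable (fun y => (y - conjMean (μ i) t) / v) := fun i => by fun_prop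
  have hcube : ∀ i (y : ℝ), |(y - conjMean (μ i) t) / v| ^ 3 =
      |y - conjMean (μ i) t| ^ 3 / v ^ 3 := fun i y => by
    rw [abs_div, div_pow, abs_of_pos hv0]
  have hi1 : ∀ i, Integrable (fun y => y) (conjLaw (μ i) t) := fun i =>
    (h i).integrable_conj_of_le ht0 ht measurable_id IsBernsteinLaw.abs_le_one_add
  have hY : IsCenteredIndep Q (fun i ω => (ω i - conjMean (μ i) t) / v) := by
    refine ⟨fun i => (hfm i).comp (measurable_pi_apply i),
      iIndepFun_pi (X := fun i y => (y - conjMean (μ i) t) / v) fun i => (hfm i).aemeasurable,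
      fun i => ?_, fun i => ?_⟩
    · have : Integrable (fun y => |(y - conjMean (μ i) t) / v| ^ 3) (conjLaw (μ i) t) := by
        simp_rw [hcube]
        exact ((h i).integrable_conj_abs_sub_pow_three ht0 ht _).div_const _
      exact (measurePreserving_eval (fun i => conjLaw (μ i) t) i).integrable_comp_of_integrable this
    · rw [hQ, integral_comp_eval_pi i (hfm i), integral_div,
        integral_sub (hi1 i) (integrable_const _)]
      simp [conjMean]
  have hvar : ∑ i, ∫ ω, ((ω i - conjMean (μ i) t) / v) ^ 2 ∂Q = 1 := by
    have e : ∀ i, ∫ ω, ((ω i - conjMean (μ i) t) / v) ^ 2 ∂Q =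
        (∫ y, (y - conjMean (μ i) t) ^ 2 ∂(conjLaw (μ i) t)) / v ^ 2 := fun i => by
      rw [hQ, integral_comp_eval_pi i ((hfm i).pow_const 2), ← integral_div]
      simp_rw [div_pow]
    simp_rw [e]
    rw [← Finset.sum_div, hv, div_self (by positivity)]
  have hthird : ∑ i, ∫ ω, |(ω i - conjMean (μ i) t) / v| ^ 3 ∂Q ≤ 1136 * r / v ^ 3 := by
    have e : ∀ i, ∫ ω, |(ω i - conjMean (μ i) t) / v| ^ 3 ∂Q ≤
        1136 * r / v ^ 3 * ∫ y, y ^ 2 ∂(μ i) := fun i => by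
      rw [hQ, integral_comp_eval_pi i (g := fun y => |(y - conjMean (μ i) t) / v| ^ 3)
        (by fun_prop)]
      simp_rw [hcube]
      rw [integral_div, div_mul_eq_mul_div]
      gcongr
      exact (h i).integral_conj_abs_sub_pow_three_le ht0 ht
    calc _ ≤ _ := Finset.sum_le_sum fun i _ => e i
      _ = _ := by rw [← Finset.mul_sum, hs, mul_one]
  have := hY.berry_esseen hvar hthird z
  have e : ∀ ω : ι → ℝ, ∑ i, (ω i - conjMean (μ i) t) / v =
      ((∑ i, ω i) - ∑ i, conjMean (μ i) t) / v := fun ω => by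
    rw [← Finset.sum_div, Finset.sum_sub_distrib]
  simpa only [e] using this

/-- At the saddle point `t` the exponential functional of the conjugate sum is the Gaussian one,
up to `O(r)`. -/
lemma integral_conj_indicator_exp_le (h : ∀ i, IsBernsteinLaw (μ i) r)
    (hs : ∑ i, ∫ y, y ^ 2 ∂(μ i) = 1) {t : ℝ} (ht0 : 0 ≤ t) (ht : t * r ≤ 1 / 1000) {v : ℝ}
    (hv0 : 0 < v)
    (hv : ∑ i, ∫ y, (y - conjMean (μ i) t) ^ 2 ∂(conjLaw (μ i) t) = v ^ 2)
    {x : ℝ} (hx : ∑ i, conjMean (μ i) t = x) :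
    ∫ ω, (Set.Ioi (0 : ℝ)).indicator (fun y => Real.exp (-(t * y))) ((∑ i, ω i) - x)
        ∂(Measure.pi fun i => conjLaw (μ i) t) ≤
      (√(2 * Real.pi))⁻¹ * mills (t * v) + 2 * (52 * (1136 * r / v ^ 3)) := by
  have hP := fun i => (h i).isProbabilityMeasure_conj (abs_mul_lt_one_of_le ht0 ht)
  set Q := Measure.pi fun i => conjLaw (μ i) t with hQ
  have hWm : Measurable (fun ω : ι → ℝ => ((∑ i, ω i) - x) / v) := by fun_prop
  have hW := Measure.isProbabilityMeasure_map (μ := Q) hWm.aemeasurable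
  have hbe : ∀ z, |(Q.map fun ω => ((∑ i, ω i) - x) / v).real (Set.Iic z) -
      (gaussianReal 0 1).real (Set.Iic z)| ≤ 52 * (1136 * r / v ^ 3) := fun z => by
    rw [map_measureReal_apply hWm measurableSet_Iic, ← cdf_eq_real, ← hx]
    exact conj_berry_esseen h hs ht0 ht hv0 hv z
  have key := integral_indicator_exp_le hbe (mul_nonneg ht0 hv0.le)
  rw [integral_exp_neg_indicator_gaussian, integral_map hWm.aemeasurable
    (Measurable.aestronglyMeasurable (Measurable.indicator (by fun_prop) measurableSet_Ioi))] at key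
  refine le_trans (le_of_eq ?_) key
  congr 1
  ext ω
  by_cases hω : 0 < (∑ i, ω i) - x
  · rw [Set.indicator_of_mem (show _ ∈ Set.Ioi (0 : ℝ) from hω),
      Set.indicator_of_mem (show _ ∈ Set.Ioi (0 : ℝ) from div_pos hω hv0)]
    congr 2
    field_simp
  · rw [Set.indicator_of_notMem (show _ ∉ Set.Ioi (0 : ℝ) from hω), Set.indicator_of_notMem]
    exact not_lt.2 (div_nonpos_of_nonpos_of_nonneg (not_lt.1 hω) hv0.le)

/-- By the choice of the saddle point, the exponential prefactor is minimal. -/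
lemma prod_integral_exp_saddle_le (h : ∀ i, IsBernsteinLaw (μ i) r) {t t' : ℝ} (ht0 : 0 ≤ t)
    (ht : t * r ≤ 1 / 1000) (ht' : |t'| * r < 1) {x : ℝ} (hx : ∑ i, conjMean (μ i) t = x) :
    (∏ i, ∫ y, Real.exp (t * y) ∂(μ i)) * Real.exp (-(t * x)) ≤
      (∏ i, ∫ y, Real.exp (t' * y) ∂(μ i)) * Real.exp (-(t' * x)) := by
  have h1 : ∏ i, ((∫ y, Real.exp (t * y) ∂(μ i)) * Real.exp ((t' - t) * conjMean (μ i) t)) ≤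
      ∏ i, ∫ y, Real.exp (t' * y) ∂(μ i) := by
    refine Finset.prod_le_prod (fun i _ => mul_nonneg (integral_nonneg fun _ =>
      (Real.exp_pos _).le) (Real.exp_pos _).le) fun i _ => ?_
    exact (h i).integral_exp_mul_exp_le ht0 ht ht'
  rw [Finset.prod_mul_distrib, ← Real.exp_sum, ← Finset.mul_sum, hx] at h1
  calc _ = (∏ i, ∫ y, Real.exp (t * y) ∂(μ i)) * Real.exp ((t' - t) * x) *
        Real.exp (-(t' * x)) := by
        rw [mul_assoc, ← Real.exp_add]; congr 2; ring
    _ ≤ _ := mul_le_mul_of_nonneg_right h1 (Real.exp_pos _).le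

/-- Replacing the argument of the Mills ratio by `b ≤ x`, where `x` and `v` are close to `t` and
`1`, costs only `O(r)`. -/
lemma mills_mul_le {t v x b : ℝ} (hr : 0 < r) (ht0 : 0 ≤ t) (ht : t * r ≤ 1 / 1000)
    (hv0 : 0 < v) (hv : |v ^ 2 - 1| ≤ 151 * (t * r)) (hx : |x - t| ≤ 150 * (t * r) * t)
    (hbx : b ≤ x) : mills (t * v) ≤ mills b + 750 * r := by
  have hθ : 0 ≤ t * r := mul_nonneg ht0 hr.le
  rcases le_total b (t * v) with hb | hb
  · linarith [mills_anti hb]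
  have h1 := abs_le.1 hv
  have h2 := abs_le.1 hx
  have hv9 : 9 / 10 ≤ v := by nlinarith
  have hv1 : 1 - v ≤ 151 * (t * r) := by nlinarith
  have hba : b - t * v ≤ 301 * r * t ^ 2 := by nlinarith
  have h3 := mills_sub_le (mul_nonneg ht0 hv0.le) hb
  have h4 : 2 * (b - t * v) / (1 + t * v) ^ 2 ≤ 750 * r := by
    rw [div_le_iff₀ (by positivity)]
    have h5 : 81 / 100 * t ^ 2 ≤ (1 + t * v) ^ 2 := by nlinarith [mul_nonneg ht0 hv0.le]
    nlinarith
  linarith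

/-- Moderate deviations: the saddle point estimate. -/
lemma measureReal_sum_gt_le_of_moderate (h : ∀ i, IsBernsteinLaw (μ i) r) (hr : 0 < r)
    (hs : ∑ i, ∫ y, y ^ 2 ∂(μ i) = 1) {δ : ℝ} (hδ : 0 ≤ δ) {x : ℝ} (hx : 0 ≤ x)
    (hxr : x * r ≤ 1 / 2000) :
    (Measure.pi μ).real {ω | x < ∑ i, ω i} ≤
      (1 - stdNormalCDF (xTilde δ r x)) * (1 + 2600000 * (1 + xTilde δ r x) * r) := by
  obtain ⟨t, ht0, ht, hmean⟩ := exists_sum_conjMean_eq h hr hs hx hxr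
  have hθ : 0 ≤ t * r := mul_nonneg ht0 hr.le
  have hvar := abs_sum_conj_variance_sub_le h hs ht0 ht
  have hdiff := abs_sum_conjMean_sub_le h hs ht0 ht
  rw [hmean] at hdiff
  have hV : 81 / 100 ≤ ∑ i, ∫ y, (y - conjMean (μ i) t) ^ 2 ∂(conjLaw (μ i) t) := by
    linarith [(abs_le.1 hvar).1]
  obtain ⟨v, hv0, hv⟩ : ∃ v : ℝ, 0 < v ∧
      ∑ i, ∫ y, (y - conjMean (μ i) t) ^ 2 ∂(conjLaw (μ i) t) = v ^ 2 :=
    ⟨_, Real.sqrt_pos.2 (by linarith), (Real.sq_sqrt (by linarith)).symm⟩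
  have hv9 : 9 / 10 ≤ v := by nlinarith
  have hfun := integral_conj_indicator_exp_le h hs ht0 ht hv0 hv hmean
  have hbx := xTilde_le_self hδ hr hx
  have hb := xTilde_nonneg (δ := δ) (r := r) hx
  have hba := xTilde_le_xTilde_zero hδ hr hx
  have ha := xTilde_nonneg (δ := 0) (r := r) hx
  have hpre : (∏ i, ∫ y, Real.exp (t * y) ∂(μ i)) * Real.exp (-(t * x)) ≤
      Real.exp (-xTilde δ r x ^ 2 / 2) := by
    have hden : 0 < 1 + r * xTilde 0 r x := by positivity
    refine (prod_integral_exp_saddle_le h ht0 ht ?_ hmean).trans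
      ((prod_integral_exp_mul_le h hr hs hx).trans ?_)
    · rw [abs_of_nonneg (by positivity), div_mul_eq_mul_div, div_lt_one hden]; linarith
    · rw [Real.exp_le_exp]
      nlinarith
  have hmills := mills_mul_le hr ht0 ht hv0 (by rwa [← hv]) hdiff hbx
  have hlow := le_mills hb
  rw [measureReal_sum_gt_eq h (abs_mul_lt_one_of_le ht0 ht) x, one_sub_stdNormalCDF]
  set b := xTilde δ r x
  have hsq := sqrt_two_pi_pos
  have hsq3 : √(2 * Real.pi) ≤ 3 := by
    rw [Real.sqrt_le_left (by norm_num)]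
    linarith [Real.pi_lt_d2]
  have hv3 : (9 / 10 : ℝ) ^ 3 ≤ v ^ 3 := by gcongr
  have herr : 2 * (52 * (1136 * r / v ^ 3)) ≤ (√(2 * Real.pi))⁻¹ * (510000 * r) := by
    have h1 : 2 * (52 * (1136 * r / v ^ 3)) ≤ 170000 * r := by
      rw [← mul_assoc, ← mul_div_assoc, div_le_iff₀ (by positivity)]
      have := mul_le_mul_of_nonneg_left hv3 (show 0 ≤ 170000 * r by positivity)
      norm_num at this
      nlinarith
    refine h1.trans ?_
    rw [← div_eq_inv_mul, le_div_iff₀ hsq]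
    nlinarith
  -- `5 * 520000 = 2600000`, by `mills b ≥ 1 / (5 (1 + b))`
  have hr_le : 520000 * r ≤ mills b * (2600000 * (1 + b) * r) := by
    rw [div_le_iff₀ (by positivity)] at hlow
    nlinarith
  calc _ ≤ Real.exp (-b ^ 2 / 2) *
        ((√(2 * Real.pi))⁻¹ * (mills b * (1 + 2600000 * (1 + b) * r))) := by
        refine mul_le_mul hpre (hfun.trans ?_) ?_ (Real.exp_pos _).le
        · have h2 : (√(2 * Real.pi))⁻¹ * mills (t * v) ≤
              (√(2 * Real.pi))⁻¹ * (mills b + 750 * r) := by gcongr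
          calc _ ≤ (√(2 * Real.pi))⁻¹ * (mills b + 750 * r) +
                (√(2 * Real.pi))⁻¹ * (510000 * r) := add_le_add h2 herr
            _ = (√(2 * Real.pi))⁻¹ * (mills b + 510750 * r) := by ring
            _ ≤ _ := by
                gcongr
                linarith
        · exact integral_nonneg fun ω => Set.indicator_nonneg (fun _ _ => (Real.exp_pos _).le) _
    _ = _ := by ring

/-- The normalized form of the inequality, for a product of Bernstein laws with total variance
`1`. -/
theorem measureReal_sum_gt_le (h : ∀ i, IsBernsteinLaw (μ i) r) (hr : 0 < r)
    (hs : ∑ i, ∫ y, y ^ 2 ∂(μ i) = 1) {δ : ℝ} (hδ : 0 < δ) (hδ1 : δ ≤ 1) {x : ℝ} (hx : 0 ≤ x) :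
    (Measure.pi μ).real {ω | x < ∑ i, ω i} ≤
      (1 - stdNormalCDF (xTilde δ r x)) *
        (1 + (2600000 + 15 * (4 * 4000 ^ 3 / δ)) * (1 + xTilde δ r x) * r) := by
  have hb := xTilde_nonneg (δ := δ) (r := r) hx
  have h1 : 0 ≤ 1 - stdNormalCDF (xTilde δ r x) := by linarith [stdNormalCDF_le_one (xTilde δ r x)]
  have h2 : 0 ≤ 15 * (4 * 4000 ^ 3 / δ) := by positivity
  rcases le_or_gt (x * r) (1 / 2000) with hxr | hxr
  · refine (measureReal_sum_gt_le_of_moderate h hr hs hδ.le hx hxr).trans ?_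
    gcongr
    linarith
  · refine (measureReal_sum_gt_le_of_large h hr hs hδ hδ1 hx hxr).trans ?_
    gcongr
    linarith

end SaddlePoint

/-! ### Normalization and the asymptotic form -/

section Transfer

variable {Ω : Type*} [MeasurableSpace Ω] {P : Measure Ω} {n : ℕ} {ξ : Fin n → Ω → ℝ} {ε : ℝ}

lemma integral_pow_map_div (hξ : ∀ i, Measurable (ξ i)) (s : ℝ) (i : Fin n) (k : ℕ) :
    ∫ y, y ^ k ∂(P.map fun ω => ξ i ω / s) = (∫ ω, ξ i ω ^ k ∂P) / s ^ k := by
  rw [integral_map ((hξ i).div_const s).aemeasurable (by fun_prop)]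
  simp_rw [div_pow]
  rw [integral_div]

lemma IsBernsteinFamily.isBernsteinLaw_map_div (h : IsBernsteinFamily P ξ ε) {s : ℝ} (hs : 0 < s)
    (i : Fin n) : IsBernsteinLaw (P.map fun ω => ξ i ω / s) (ε / s) where
  pos := div_pos h.eps_pos hs
  integrable_pow k := by
    rw [integrable_map_measure (by fun_prop) ((h.measurable i).div_const s).aemeasurable]
    simp_rw [Function.comp_def, div_pow]
    exact (h.integrable_pow i k).div_const _
  centered := by
    simpa [h.centered i] using integral_pow_map_div (P := P) h.measurable s i 1
  bernstein k hk := by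
    rw [integral_pow_map_div h.measurable, integral_pow_map_div h.measurable, abs_div,
      abs_of_pos (pow_pos hs k), div_le_iff₀ (pow_pos hs k)]
    refine (h.bernstein i k hk).trans_eq ?_
    obtain ⟨j, rfl⟩ := Nat.exists_eq_add_of_le' (show 2 ≤ k by omega)
    rw [Nat.add_sub_cancel, div_pow, pow_add]
    field_simp

/-- The inequality with an explicit constant; the law of `ξ / σ` is a product of Bernstein laws. -/
theorem IsBernsteinFamily.sumTail_le [IsProbabilityMeasure P] (h : IsBernsteinFamily P ξ ε)
    (hσ : 0 < sumSigma P ξ) {δ : ℝ} (hδ : 0 < δ) (hδ1 : δ ≤ 1) {x : ℝ} (hx : 0 ≤ x) :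
    sumTail P ξ x ≤
      (1 - stdNormalCDF (xTilde δ (ε / sumSigma P ξ) x)) *
        (1 + (2600000 + 15 * (4 * 4000 ^ 3 / δ)) * (1 + xTilde δ (ε / sumSigma P ξ) x) *
          (ε / sumSigma P ξ)) := by
  have hsq : sumSigma P ξ ^ 2 = ∑ i, ∫ ω, ξ i ω ^ 2 ∂P :=
    Real.sq_sqrt (Real.sqrt_pos.1 hσ).le
  set s := sumSigma P ξ with hs
  have hm : ∀ i, Measurable fun ω => ξ i ω / s := fun i => (h.measurable i).div_const s
  have hprob : ∀ i, IsProbabilityMeasure (P.map fun ω => ξ i ω / s) :=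
    fun i => Measure.isProbabilityMeasure_map (hm i).aemeasurable
  have hind : iIndepFun (fun i ω => ξ i ω / s) P :=
    h.indep.comp (fun _ y => y / s) fun _ => measurable_id.div_const s
  have hmap := (iIndepFun_iff_map_fun_eq_pi_map fun i => (hm i).aemeasurable).1 hind
  have hsum : ∑ i, ∫ y, y ^ 2 ∂(P.map fun ω => ξ i ω / s) = 1 := by
    simp_rw [integral_pow_map_div h.measurable]
    rw [← Finset.sum_div, ← hsq, div_self (by positivity)]
  have key := measureReal_sum_gt_le (h.isBernsteinLaw_map_div hσ) (div_pos h.eps_pos hσ) hsum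
    hδ hδ1 hx
  rw [← hmap, map_measureReal_apply (measurable_pi_lambda _ hm)
    (measurableSet_lt measurable_const (by fun_prop))] at key
  refine le_of_eq_of_le ?_ key
  rw [sumTail]
  congr 1
  ext ω
  simp only [Set.mem_ofPred_eq, Set.mem_preimage, ← Finset.sum_div, gt_iff_lt, ← hs, lt_div_iff₀ hσ]

end Transfer
theorem theorem1 :
    ∀ δ : ℝ, 0 < δ → δ ≤ 1 →
      -- the inequality, with a constant depending only on `δ`
      (∃ C : ℝ, ∀ {Ω : Type*} [MeasurableSpace Ω] (P : Measure Ω) [IsProbabilityMeasure P]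
          (n : ℕ) (ξ : Fin n → Ω → ℝ) (ε : ℝ),
          IsBernsteinFamily P ξ ε → 0 < sumSigma P ξ →
          ∀ x : ℝ, 0 ≤ x →
            sumTail P ξ x ≤
              (1 - stdNormalCDF (xTilde δ (ε / sumSigma P ξ) x)) *
                (1 + C * (1 + xTilde δ (ε / sumSigma P ξ) x) * (ε / sumSigma P ξ))) ∧
      -- the asymptotic form for `0 ≤ x = o(σ / ε)`, `ε / σ → 0`, along an arbitrary family
      (∀ {ι : Type*} (l : Filter ι) {Ω : ι → Type*} [∀ j, MeasurableSpace (Ω j)]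
          (P : ∀ j, Measure (Ω j)) [∀ j, IsProbabilityMeasure (P j)]
          (n : ι → ℕ) (ξ : ∀ j, Fin (n j) → Ω j → ℝ) (ε x : ι → ℝ),
          (∀ j, IsBernsteinFamily (P j) (ξ j) (ε j)) →
          (∀ j, 0 < sumSigma (P j) (ξ j)) →
          (∀ j, 0 ≤ x j) →
          x =o[l] (fun j => sumSigma (P j) (ξ j) / ε j) →
          Tendsto (fun j => ε j / sumSigma (P j) (ξ j)) l (𝓝 0) →
          ∃ r : ι → ℝ, r =o[l] (fun _ => (1 : ℝ)) ∧
            ∀ j, sumTail (P j) (ξ j) (x j) ≤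
              (1 - stdNormalCDF (xTilde δ (ε j / sumSigma (P j) (ξ j)) (x j))) * (1 + r j)) := by
  intro δ hδ hδ1
  refine ⟨⟨_, fun P _ n ξ ε h hσ x hx => h.sumTail_le hσ hδ hδ1 hx⟩, ?_⟩
  intro ι l Ω _ P _ n ξ ε x h hσ hx hxo hr0
  refine ⟨_, ?_, fun j => (h j).sumTail_le (hσ j) hδ hδ1 (hx j)⟩
  rw [isLittleO_one_iff]
  have hr : ∀ j, 0 < ε j / sumSigma (P j) (ξ j) := fun j => div_pos (h j).eps_pos (hσ j)
  have hxr : Tendsto (fun j => x j * (ε j / sumSigma (P j) (ξ j))) l (𝓝 0) := by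
    simpa only [div_div_eq_mul_div, mul_div_assoc] using hxo.tendsto_div_nhds_zero
  -- `0 ≤ x̃ ≤ x`, so `x̃ ε / σ` vanishes together with `x ε / σ`
  have hxtr : Tendsto (fun j => xTilde δ (ε j / sumSigma (P j) (ξ j)) (x j) *
      (ε j / sumSigma (P j) (ξ j))) l (𝓝 0) :=
    squeeze_zero (fun j => mul_nonneg (xTilde_nonneg (hx j)) (hr j).le)
      (fun j => mul_le_mul_of_nonneg_right (xTilde_le_self hδ.le (hr j) (hx j)) (hr j).le) hxr
  have := (hr0.add hxtr).const_mul (2600000 + 15 * (4 * 4000 ^ 3 / δ))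
  simp only [add_zero, mul_zero] at this
  refine this.congr fun j => ?_
  ring
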